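/- **Setting.** Let $d\ge 1$ be an integer and let $\mathcal T\subset\mathbb R^d$ be compact. For each $n\in\{0,1,2,\dots\}$ let $m_n,l_n\ge 0$ be integers, let $H_j=[3j-1,3j+1]^d$ for $j=1,\dots,m_n$, and let $S_n$ be the disjoint union of $U_n=\bigcup_{j\le m_n}H_j$ and a set $D_n$ of $l_n$ further points. Let $\nu_n$ be Lebesgue measure on $U_n$ and counting measure on $D_n$, and let $X_n=L^2(S_n,\nu_n)$, with inner product $\langle\cdot,\cdot\rangle$ and norm $\|\cdot\|$. For $x\in X_n$ write $\tilde x=x\mathbf 1_{U_n}$ (functional part) and $\bar x=x|_{D_n}\in\mathbb R^{l_n}$ (discrete part). A parameter is a triple $\theta=(a,b,c)\in C(\mathcal T,X_n)\times C(\mathcal T)\times X_n$. Put $$\mathcal L_\infty(x;\theta)=\langle c,x\rangle+\Big(\max_{t\in\mathcal T}\big(b(t)-\langle a(t),x\rangle\big)\Big)^+ ,\qquad \beta(\theta)=\inf\{\langle c,x\rangle: x\in X_n,\ \langle a(t),x\rangle\ge b(t)\ \forall t\in\mathcal T\}.$$ Fix $z\in[1,\infty]$ with conjugate exponent $z^*$.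 For $\gamma=(\tilde\gamma,\bar\gamma)$ with $\tilde\gamma,\bar\gamma>0$ let $B_\gamma=\{x\in X_n:\|\tilde x\|\le\tilde\gamma,\ \|\bar x\|_z\le\bar\gamma\}$ and $$\beta_\infty(\theta;\gamma)=\inf_{x\in B_\gamma}\mathcal L_\infty(x;\theta),\qquad \Delta(\theta;\gamma)=\beta_\infty(\theta;\gamma)-\beta(\theta).$$ For $J=(k_1,\dots,k_{m_n})$ with $k_i$ nonnegative integers let $\mathbf P_J\subset X_n$ be the finite-dimensional space of those $x$ for which $x|_{H_i}$ is a polynomial of total degree at most $k_i$ for every $i\le m_n$, let $\mathbf p_J$ be the orthogonal projection of $X_n$ onto $\mathbf P_J$, and let $\beta_J(\theta;\gamma)=\inf_{x\in B_\gamma\cap\mathbf P_J}\mathcal L_\infty(x;\theta)$. **Assumptions.** Let $\theta_n=(a_n,b_n,c_n)\in C(\mathcal T,X_n)\times C(\mathcal T)\times X_n$, $n\ge 0$, be such that 1. for every $n$ there is $s_n^*\in D_n$ with $a_n(t)(s_n^*)=c_n(s_n^*)=1$ for all $t\in\mathcal T$, and there is a finite positive Borel measure $\mu_n$ on $\mathcal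 T$ with $c_n=\int a_n(t)\,d\mu_n(t)$; 2. $\beta(\theta_n)$ does not depend on $n$; 3. for every $n\ge 1$ and every $x_0\in X_{n-1}$ there is $x_1\in X_n$ with $\|\tilde x_1\|\le\|\tilde x_0\|$, $\|\bar x_1\|_z\le\|\bar x_0\|_z$ and $\mathcal L_\infty(x_1;\theta_n)=\mathcal L_\infty(x_0;\theta_{n-1})$. For every $n$ let $\hat\theta_n=(\hat a_n,\hat b_n,\hat c_n)\in C(\mathcal T,X_n)\times C(\mathcal T)\times X_n$ be arbitrary, let $J_n=(k_{n,1},\dots,k_{n,m_n})$ be as above, and let $\gamma_n=(\tilde\gamma_n,\bar\gamma_n)$ with $\tilde\gamma_n,\bar\gamma_n>0$. Define $$\delta^a_n=\tilde\gamma_n\sup_{t\in\mathcal T}\|\hat{\tilde a}_n(t)-\tilde a_n(t)\|+\bar\gamma_n\sup_{t\in\mathcal T}\|\hat{\bar a}_n(t)-\bar a_n(t)\|_{z^*},\qquad \delta^b_n=\sup_{t\in\mathcal T}|\hat b_n(t)-b_n(t)|,$$ $$\delta^c_n=\tilde\gamma_n\|\hat{\tilde c}_n-\tilde c_n\|+\bar\gamma_n\|\hat{\bar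 c}_n-\bar c_n\|_{z^*},\qquad \delta^p_n=\tilde\gamma_n\Big(\|(I-\mathbf p_{J_n})\tilde c_n\|+\max_{t\in\mathcal T}\|(I-\mathbf p_{J_n})\tilde a_n(t)\|\Big).$$ **Theorem.** For every $n\ge 0$, $$-\sum_{j=a,b,c}\delta^j_n\ \le\ \beta_{J_n}(\hat\theta_n;\gamma_n)-\beta(\theta_0)\ \le\ \sum_{j=a,b,c,p}\delta^j_n+\Delta(\theta_n;\gamma_n),\qquad\text{and}\quad \Delta(\theta_n;\gamma_n)\le\Delta(\theta_0;\gamma_n).$$ Moreover, for every integer $r\ge 1$ there is a constant $\tilde C>0$, depending only on $d$ and $r$, with the following property. Suppose in addition that for some $C>0$, for all $n$, all $i\le m_n$ and all $t\in\mathcal T$, the restrictions of $c_n$ and $a_n(t)$ to the interior $\tilde H_i$ of $H_i$ lie in the Sobolev space $W^{r,2}(\tilde H_i)$ with norms at most $C$, where $\|f\|_{W^{r,2}}=\big(\sum_{|\alpha|\le r}\|\partial^\alpha f\|_{L^2}^2\big)^{1/2}$. Then, for every $n$ such that $m_n\ge1$ and $\kappa_n:=\min_{i}k_{n,i}\ge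 r$, $$\delta^p_n\ \le\ \tilde\gamma_n\, m_n\, C\,\tilde C\,\kappa_n^{-r}.$$ -/

import Mathlib

open MeasureTheory
open scoped ENNReal ContDiff

namespace GOT

noncomputable section

/-! ## The index space and the Hilbert space `X` -/

/-- The closed cube `[t - 1, t + 1] ^ d`. -/
def cube (d : ℕ) (t : ℝ) : Set (Fin d → ℝ) :=
  Set.Icc (fun _ => t - 1) (fun _ => t + 1)

/-- The open cube `(t - 1, t + 1) ^ d`, the interior of `cube d t`. -/
def openCube (d : ℕ) (t : ℝ) : Set (Fin d → ℝ) :=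
  Set.pi Set.univ fun _ => Set.Ioo (t - 1) (t + 1)

/-- The centre of the `j`-th cube; the index `j = 0, …, m - 1` gives `3, 6, …, 3 m`. -/
def center {m : ℕ} (j : Fin m) : ℝ := 3 * ((j : ℝ) + 1)

/-- The union of the `m` cubes. -/
def cubes (d m : ℕ) : Set (Fin d → ℝ) := ⋃ j : Fin m, cube d (center j)

/-- The index set is the disjoint union of the cubes and of `l` further points. It is carried by
`(Fin d → ℝ) ⊕ Fin l` with the measure `ν` which is Lebesgue measure on the cubes (and gives no
mass to their complement) and gives mass one to each of the `l` points. -/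
def nu (d m l : ℕ) : Measure ((Fin d → ℝ) ⊕ Fin l) :=
  (volume.restrict (cubes d m)).map Sum.inl + Measure.count.map Sum.inr

/-- The Hilbert space `X = L²(ν)`. -/
abbrev X (d m l : ℕ) : Type := Lp ℝ 2 (nu d m l)

variable {d m l : ℕ}

/-- The functional part `x̃` of `x`, as an element of `X` that vanishes at the `l` points. -/
def funPart (x : X d m l) : X d m l :=
  ((Lp.memLp x).indicator (measurableSet_range_inl (α := Fin d → ℝ) (β := Fin l))).toLp
    ((Set.range Sum.inl).indicator x)

/-- The discrete part `x̄ ∈ ℝ^l` of `x`. -/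
def discPart (x : X d m l) : Fin l → ℝ := fun i => x (Sum.inr i)

/-- The `ℓ^z`-norm on `ℝ^l`, for `1 ≤ z ≤ ∞`. -/
def lzNorm (z : ℝ≥0∞) (v : Fin l → ℝ) : ℝ := ‖(WithLp.toLp z v : PiLp z fun _ : Fin l => ℝ)‖

/-! ## Parameters, the primary program and its penalized versions -/

/-- A parameter `θ = (a, b, c) ∈ C(𝒯, X) × C(𝒯) × X`. -/
structure Param (T : TopologicalSpace.Compacts (Fin d → ℝ)) (m l : ℕ) where
  a : C(T, X d m l)
  b : C(T, ℝ)
  c : X d m l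

variable {T : TopologicalSpace.Compacts (Fin d → ℝ)}

/-- The penalty function `⟨c, x⟩ + (max_t (b t - ⟨a t, x⟩))⁺`. -/
def penalty (θ : Param T m l) (x : X d m l) : ℝ :=
  inner ℝ θ.c x + max (⨆ t : T, (θ.b t - inner ℝ (θ.a t) x)) 0

/-- The value of the primary program: minimize `⟨c, x⟩` subject to `⟨a t, x⟩ - b t ≥ 0` for
all `t`. -/
def beta (θ : Param T m l) : ℝ :=
  sInf ((fun x : X d m l => inner ℝ θ.c x) '' {x | ∀ t : T, 0 ≤ inner ℝ (θ.a t) x - θ.b t})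

/-- The set `B_γ` of those `x` with `‖x̃‖ ≤ γ₁` and `‖x̄‖_z ≤ γ₂`, where `γ = (γ₁, γ₂)`. -/
def ball (z : ℝ≥0∞) (γ : ℝ × ℝ) : Set (X d m l) :=
  {x | ‖funPart x‖ ≤ γ.1 ∧ lzNorm z (discPart x) ≤ γ.2}

/-- The value of the penalized program over `B_γ`. -/
def betaInf (z : ℝ≥0∞) (θ : Param T m l) (γ : ℝ × ℝ) : ℝ :=
  sInf (penalty θ '' ball z γ)

/-- The compactification error `Δ(θ; γ)`. -/
def Delta (z : ℝ≥0∞) (θ : Param T m l) (γ : ℝ × ℝ) : ℝ := betaInf z θ γ - beta θ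

/-! ## The sieve space of piecewise polynomials -/

lemma map_inl_le_nu : (volume.restrict (cubes d m)).map Sum.inl ≤ nu d m l :=
  Measure.le_add_right le_rfl

lemma ae_cube_of_ae_nu {P : (Fin d → ℝ) ⊕ Fin l → Prop} (h : ∀ᵐ s ∂nu d m l, P s) (i : Fin m) :
    ∀ᵐ y ∂volume.restrict (cube d (center i)), P (Sum.inl y) := by
  have h1 : ∀ᵐ s ∂(volume.restrict (cubes d m)).map (Sum.inl : _ → (Fin d → ℝ) ⊕ Fin l), P s :=
    (Measure.absolutelyContinuous_of_le map_inl_le_nu).ae_le h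
  have h2 : ∀ᵐ y ∂volume.restrict (cubes d m), P (Sum.inl y) :=
    ae_of_ae_map measurable_inl.aemeasurable h1
  exact (Measure.absolutelyContinuous_of_le
    (Measure.restrict_mono (Set.subset_iUnion _ i) le_rfl)).ae_le h2

/-- The space `𝐏_J` of all `x ∈ X` whose restriction to the `i`-th cube is a polynomial of (total)
degree at most `J i`, for every `i`; there is no restriction at the `l` points. -/
def polySpace (d l : ℕ) (J : Fin m → ℕ) : Submodule ℝ (X d m l) where
  carrier := {x | ∀ i : Fin m, ∃ p : MvPolynomial (Fin d) ℝ, p.totalDegree ≤ J i ∧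
    ∀ᵐ y ∂volume.restrict (cube d (center i)), x (Sum.inl y) = MvPolynomial.eval y p}
  add_mem' := by
    intro x x' hx hx' i
    obtain ⟨p, hp, hxp⟩ := hx i
    obtain ⟨q, hq, hxq⟩ := hx' i
    refine ⟨p + q, (MvPolynomial.totalDegree_add p q).trans (max_le hp hq), ?_⟩
    filter_upwards [hxp, hxq, ae_cube_of_ae_nu (Lp.coeFn_add x x') i] with y h1 h2 h3
    rw [h3, Pi.add_apply, h1, h2, map_add]
  zero_mem' := by
    intro i
    refine ⟨0, by simp, ?_⟩
    filter_upwards [ae_cube_of_ae_nu (Lp.coeFn_zero ℝ 2 (nu d m l)) i] with y h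
    simpa using h
  smul_mem' := by
    intro r x hx i
    obtain ⟨p, hp, hxp⟩ := hx i
    refine ⟨r • p, (MvPolynomial.totalDegree_smul_le r p).trans hp, ?_⟩
    filter_upwards [hxp, ae_cube_of_ae_nu (Lp.coeFn_smul r x) i] with y h1 h2
    rw [h2, Pi.smul_apply, h1, MvPolynomial.smul_eval, smul_eq_mul]

lemma quasi_inl (i : Fin m) :
    Measure.QuasiMeasurePreserving (Sum.inl : (Fin d → ℝ) → (Fin d → ℝ) ⊕ Fin l)
      (volume.restrict (cube d (center i))) (nu d m l) :=
  ⟨measurable_inl, ((Measure.absolutelyContinuous_of_le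
    (Measure.restrict_mono (Set.subset_iUnion _ i) le_rfl)).map measurable_inl).trans
      (Measure.absolutelyContinuous_of_le map_inl_le_nu)⟩

/-- The restriction of `x ∈ X` to the `i`-th cube. -/
def restr (l : ℕ) (i : Fin m) :
    X d m l →ₗ[ℝ] (Fin d → ℝ) →ₘ[volume.restrict (cube d (center i))] ℝ where
  toFun x := AEEqFun.mk (fun y => x (Sum.inl y))
    ((Lp.aestronglyMeasurable x).comp_quasiMeasurePreserving (quasi_inl i))
  map_add' x x' := by
    rw [AEEqFun.mk_add_mk]
    refine AEEqFun.mk_eq_mk.2 ?_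
    filter_upwards [ae_cube_of_ae_nu (Lp.coeFn_add x x') i] with y h
    exact h
  map_smul' r x := by
    rw [RingHom.id_apply, AEEqFun.smul_mk]
    refine AEEqFun.mk_eq_mk.2 ?_
    filter_upwards [ae_cube_of_ae_nu (Lp.coeFn_smul r x) i] with y h
    exact h

/-- Polynomials as functions on the `i`-th cube. -/
def polyRestr (i : Fin m) :
    MvPolynomial (Fin d) ℝ →ₗ[ℝ] (Fin d → ℝ) →ₘ[volume.restrict (cube d (center i))] ℝ where
  toFun p := AEEqFun.mk (fun y => MvPolynomial.eval y p)
    (MvPolynomial.continuous_eval p).aestronglyMeasurable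
  map_add' p q := by
    rw [AEEqFun.mk_add_mk]
    refine AEEqFun.mk_eq_mk.2 (Filter.Eventually.of_forall fun y => ?_)
    simp
  map_smul' r p := by
    rw [RingHom.id_apply, AEEqFun.smul_mk]
    refine AEEqFun.mk_eq_mk.2 (Filter.Eventually.of_forall fun y => ?_)
    simp [MvPolynomial.smul_eval]

lemma embedding_inl : MeasurableEmbedding (Sum.inl : (Fin d → ℝ) → (Fin d → ℝ) ⊕ Fin l) :=
  ⟨Sum.inl_injective, measurable_inl, fun _ hs => hs.inl_image⟩

lemma embedding_inr : MeasurableEmbedding (Sum.inr : Fin l → (Fin d → ℝ) ⊕ Fin l) :=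
  ⟨Sum.inr_injective, measurable_inr, fun _ hs => hs.inr_image⟩

lemma ae_nu_of {P : (Fin d → ℝ) ⊕ Fin l → Prop}
    (h1 : ∀ i : Fin m, ∀ᵐ y ∂volume.restrict (cube d (center i)), P (Sum.inl y))
    (h2 : ∀ i : Fin l, P (Sum.inr i)) : ∀ᵐ s ∂nu d m l, P s := by
  rw [nu, ae_add_measure_iff]
  constructor
  · rw [embedding_inl.ae_map_iff, cubes, ae_restrict_iUnion_eq]
    simpa using h1
  · rw [embedding_inr.ae_map_iff]
    exact Filter.Eventually.of_forall h2

lemma discPart_eq_of_ae {f g : (Fin d → ℝ) ⊕ Fin l → ℝ} (h : f =ᵐ[nu d m l] g) (i : Fin l) :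
    f (Sum.inr i) = g (Sum.inr i) := by
  have h1 : ∀ᵐ s ∂Measure.count.map Sum.inr, f s = g s := (ae_add_measure_iff.1 h).2
  rw [embedding_inr.ae_map_iff, Measure.ae_count_iff] at h1
  exact h1 i

instance (l : ℕ) (J : Fin m → ℕ) : FiniteDimensional ℝ (polySpace d l J) := by
  let V (i : Fin m) := (MvPolynomial.restrictTotalDegree (Fin d) ℝ (J i)).map (polyRestr i)
  have hV (i : Fin m) : FiniteDimensional ℝ (V i) := inferInstance
  let D : X d m l →ₗ[ℝ] (Fin l → ℝ) :=
    { toFun := discPart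
      map_add' := fun x x' => funext fun i => discPart_eq_of_ae (Lp.coeFn_add x x') i
      map_smul' := fun r x => funext fun i => discPart_eq_of_ae (Lp.coeFn_smul r x) i }
  let R (i : Fin m) : polySpace d l J →ₗ[ℝ] V i :=
    LinearMap.codRestrict (V i) (restr l i ∘ₗ (polySpace d l J).subtype) (by
      rintro ⟨x, hx⟩
      obtain ⟨p, hp, hxp⟩ := hx i
      exact ⟨p, (MvPolynomial.mem_restrictTotalDegree _ _ _).2 hp,
        AEEqFun.mk_eq_mk.2 (hxp.mono fun y hy => hy.symm)⟩)
  let L := (LinearMap.pi R).prod (D ∘ₗ (polySpace d l J).subtype)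
  refine FiniteDimensional.of_injective L ?_
  rintro ⟨x, hx⟩ ⟨x', hx'⟩ h
  have h1 := congrArg Prod.fst h
  have h2 : discPart x = discPart x' := congrArg Prod.snd h
  refine Subtype.ext (Lp.ext (ae_nu_of (fun i => ?_) fun i => congrFun h2 i))
  have h3 : restr l i x = restr l i x' := congrArg Subtype.val (congrFun h1 i)
  exact AEEqFun.mk_eq_mk.1 h3

/-- The orthogonal projection of `X` onto `𝐏_J`. -/
def proj (l : ℕ) (J : Fin m → ℕ) : X d m l →L[ℝ] X d m l :=
  (polySpace d l J).starProjection

/-- The value of the penalized program over `B_γ ∩ 𝐏_J`. -/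
def betaJ (z : ℝ≥0∞) (J : Fin m → ℕ) (θ : Param T m l) (γ : ℝ × ℝ) : ℝ :=
  sInf (penalty θ '' (ball z γ ∩ (polySpace d l J : Set (X d m l))))

/-! ## Sobolev spaces -/

/-- The partial derivative in the `i`-th coordinate. -/
def partialDeriv (i : Fin d) (f : (Fin d → ℝ) → ℝ) : (Fin d → ℝ) → ℝ :=
  fun x => fderiv ℝ f x (Pi.single i 1)

/-- The iterated partial derivative `∂^α f`. -/
def multiDeriv (α : Fin d → ℕ) (f : (Fin d → ℝ) → ℝ) : (Fin d → ℝ) → ℝ :=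
  (List.finRange d).foldr (fun i g => (partialDeriv i)^[α i] g) f

/-- `g` is a weak derivative of `f` of order `α` on the open set `Ω`. -/
def IsWeakDeriv (Ω : Set (Fin d → ℝ)) (α : Fin d → ℕ) (f g : (Fin d → ℝ) → ℝ) : Prop :=
  ∀ φ : (Fin d → ℝ) → ℝ, ContDiff ℝ ∞ φ → HasCompactSupport φ → tsupport φ ⊆ Ω →
    ∫ y in Ω, f y * multiDeriv α φ y = (-1) ^ (∑ i, α i) * ∫ y in Ω, g y * φ y

/-- `f` has a square-integrable weak derivative of order `α` on `Ω`. -/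
def HasL2WeakDeriv (Ω : Set (Fin d → ℝ)) (α : Fin d → ℕ) (f : (Fin d → ℝ) → ℝ) : Prop :=
  ∃ g, MemLp g 2 (volume.restrict Ω) ∧ IsWeakDeriv Ω α f g

/-- The multi-indices of order at most `r`. -/
def multiIndices (d r : ℕ) : Finset (Fin d → ℕ) :=
  (Fintype.piFinset fun _ : Fin d => Finset.range (r + 1)).filter fun α => ∑ i, α i ≤ r

/-- `f ∈ W^{r,2}(Ω)`. -/
def MemSobolev (Ω : Set (Fin d → ℝ)) (r : ℕ) (f : (Fin d → ℝ) → ℝ) : Prop :=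
  MemLp f 2 (volume.restrict Ω) ∧ ∀ α ∈ multiIndices d r, HasL2WeakDeriv Ω α f

open Classical in
/-- The weak derivative of order `α` of `f` on `Ω` (zero if there is none in `L²`). -/
def weakDeriv (Ω : Set (Fin d → ℝ)) (α : Fin d → ℕ) (f : (Fin d → ℝ) → ℝ) : (Fin d → ℝ) → ℝ :=
  if h : HasL2WeakDeriv Ω α f then h.choose else 0

/-- The Sobolev norm `(∑_{|α| ≤ r} ‖∂^α f‖²)^{1/2}` of `W^{r,2}(Ω)`. -/
def sobolevNorm (Ω : Set (Fin d → ℝ)) (r : ℕ) (f : (Fin d → ℝ) → ℝ) : ℝ :=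
  √(∑ α ∈ multiIndices d r, ∫ y in Ω, weakDeriv Ω α f y ^ 2)

/-! ## Assumptions -/

/-- Regularity of `θ`: for one of the `l` points `s*` one has `a(t)(s*) = c(s*) = 1` for all `t`,
and the dual program is feasible, that is, `c = ∫ a dμ` for a finite positive Borel measure `μ` on
`𝒯`. (Continuity of `a` and `b` is part of `Param`.) -/
def Regular (θ : Param T m l) : Prop :=
  (∃ s : Fin l, (∀ t : T, discPart (θ.a t) s = 1) ∧ discPart θ.c s = 1) ∧
  ∃ μ : Measure T, IsFiniteMeasure μ ∧ θ.c = ∫ t, θ.a t ∂μ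

/-- The assumptions on a sequence of changing parameters `θ_n` over the spaces
`X_n = X d (m n) (l n)`. -/
structure Changing (z : ℝ≥0∞) {m l : ℕ → ℕ} (θ : ∀ n, Param T (m n) (l n)) : Prop where
  regular : ∀ n, Regular (θ n)
  const : ∀ n, beta (θ n) = beta (θ 0)
  monotone : ∀ n, ∀ x₀ : X d (m n) (l n), ∃ x₁ : X d (m (n + 1)) (l (n + 1)),
    ‖funPart x₁‖ ≤ ‖funPart x₀‖ ∧ lzNorm z (discPart x₁) ≤ lzNorm z (discPart x₀) ∧
    penalty (θ (n + 1)) x₁ = penalty (θ n) x₀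

/-- Sobolev smoothness of order `r` with bound `C` of an element of `X` on each of the cubes. -/
def SmoothElt (r : ℕ) (C : ℝ) (x : X d m l) : Prop :=
  ∀ i : Fin m, MemSobolev (openCube d (center i)) r (fun y => x (Sum.inl y)) ∧
    sobolevNorm (openCube d (center i)) r (fun y => x (Sum.inl y)) ≤ C

/-- Sobolev smoothness of order `r` with bound `C` of `c` and of all `a t`. -/
def Smooth (r : ℕ) (C : ℝ) (θ : Param T m l) : Prop :=
  SmoothElt r C θ.c ∧ ∀ t : T, SmoothElt r C (θ.a t)

/-! ## The error terms -/

/-- The error term `δ^a`. -/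
def deltaA (zs : ℝ≥0∞) (γ : ℝ × ℝ) (θh θ : Param T m l) : ℝ :=
  γ.1 * (⨆ t : T, ‖funPart (θh.a t) - funPart (θ.a t)‖) +
    γ.2 * ⨆ t : T, lzNorm zs (discPart (θh.a t) - discPart (θ.a t))

/-- The error term `δ^b`. -/
def deltaB (θh θ : Param T m l) : ℝ := ⨆ t : T, |θh.b t - θ.b t|

/-- The error term `δ^c`. -/
def deltaC (zs : ℝ≥0∞) (γ : ℝ × ℝ) (θh θ : Param T m l) : ℝ :=
  γ.1 * ‖funPart θh.c - funPart θ.c‖ + γ.2 * lzNorm zs (discPart θh.c - discPart θ.c)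

/-- The error term `δ^p` of polynomial approximation. -/
def deltaP (J : Fin m → ℕ) (γ : ℝ × ℝ) (θ : Param T m l) : ℝ :=
  γ.1 * (‖funPart θ.c - proj l J (funPart θ.c)‖ +
    ⨆ t : T, ‖funPart (θ.a t) - proj l J (funPart (θ.a t))‖)

end

end GOT

/-!
The estimates of the values rest on the exactness of the penalty: since `a t` and `c` are all `1`
at the point `s*`, raising the coordinate `s*` of `x` by the largest violation of a constraint
yields a feasible point whose objective is the penalty function at `x`
(`GOT.Regular.beta_le_penalty`), and dual feasibility keeps the primary program bounded below. By
Hölder's inequality on `B_γ` the penalty functions of two parameters differ by at most `δ^a + δ^b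
+ δ^c` (`GOT.abs_penalty_sub_le`). The projection onto the sieve space acts on the functional part
only, so that it maps `B_γ` into itself and, being self-adjoint, costs at most `δ^p`
(`GOT.penalty_proj_le`).

The rate of `δ^p` is a Jackson estimate in `L²` of a cube (`GOT.MemSobolev.exists_poly`). It uses
the operators `Aᵢ p = ∂ᵢ^r (((Xᵢ - t)² - 1)^r ∂ᵢ^r p)`, which are Sturm-Liouville operators of
order `2 r` for the Legendre polynomials. They do not raise degrees and multiply the coefficients
of top degree by `(n + r)! / (n - r)!`, where `n ≥ r` is the exponent of `Xᵢ`, or by `0` if `n < r`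
(`Legendre.coeff_legendreOp`). Hence `∑ Aᵢ`, which is symmetric in `L²`, has only eigenvalues of
order at least `k ^ (2 r)` on the orthogonal complement of the polynomials of degree at most `k`
within those of degree at most `K`. Let `u` be the difference of the projections of `f` onto the
polynomials of degrees at most `K` and `k`, and write `u = ∑ Aᵢ w`. Integrating by parts, `‖u‖² =
⟪f, u⟫ = ∑ ∫ ∂ᵢ^r f · (1 - (yᵢ - t)²)^r ∂ᵢ^r w`, and the Cauchy-Schwarz inequality bounds this by
the norms of the `∂ᵢ^r f` and the energy `⟪∑ Aᵢ w, w⟫`, which is of order at most `k ^ (-2 r)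
‖u‖²` (`GOT.norm_starProjection_sub_le`). As `K → ∞`, polynomials being dense, this estimates the
distance of `f` from the polynomials of degree at most `k`.

The integration by parts needs the identity defining weak derivatives for polynomials that are not
test functions, but vanish to order `r` on the two faces orthogonal to the `i`-th axis. One
derivative at a time it follows by cutting off near the boundary: the `i`-th derivative of the
cutoff function is unbounded, but its product with a factor vanishing on those two faces is not
(`GOT.HasWeakPartial.integral_mul_pderiv`).
-/

namespace Legendre
open MvPolynomial

/-! ### Legendre operators on polynomials -/

variable {d : ℕ}

lemma exists_degree_eq_totalDegree {p : MvPolynomial (Fin d) ℝ} (h : p ≠ 0) :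
    ∃ b ∈ p.support, p.totalDegree = b.degree := by
  obtain ⟨b, hb, hdeg⟩ := Finset.exists_mem_eq_sup p.support (support_nonempty.2 h)
    fun s => s.sum fun _ e => e
  exact ⟨b, hb, hdeg⟩

lemma coeff_iterate_pderiv (i : Fin d) (r : ℕ) (p : MvPolynomial (Fin d) ℝ) (m : Fin d →₀ ℕ) :
    coeff m ((pderiv i)^[r] p) =
      coeff (m + Finsupp.single i r) p * ((m i + r).descFactorial r : ℕ) := by
  induction r generalizing p with
  | zero => simp
  | succ r ih =>
    rw [Function.iterate_succ_apply, ih, coeff_pderiv, add_assoc, ← Finsupp.single_add,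
      ← add_assoc, Nat.succ_descFactorial_succ]
    simp only [Finsupp.add_apply, Finsupp.single_eq_same]
    push_cast
    ring

lemma totalDegree_iterate_pderiv (i : Fin d) (r : ℕ) {p : MvPolynomial (Fin d) ℝ}
    (h : (pderiv i)^[r] p ≠ 0) : ((pderiv i)^[r] p).totalDegree + r ≤ p.totalDegree := by
  obtain ⟨b, hb, hdeg⟩ := exists_degree_eq_totalDegree h
  rw [mem_support_iff, coeff_iterate_pderiv] at hb
  have h1 : b + Finsupp.single i r ∈ p.support := mem_support_iff.2 (left_ne_zero_of_mul hb)
  have h2 := le_totalDegree h1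
  rw [hdeg]
  refine le_trans (le_of_eq ?_) h2
  rw [Finsupp.sum_add_index' (by simp) (by simp), Finsupp.sum_single_index rfl]
  rfl

/-- The polynomial `(X i - t) ^ 2 - 1`, which vanishes on the two faces orthogonal to the `i`-th
axis of the cube of centre `t` and is negative on its interior. -/
noncomputable def facePoly (t : ℝ) (i : Fin d) : MvPolynomial (Fin d) ℝ := (X i - C t) ^ 2 - 1

lemma totalDegree_facePoly_sub (t : ℝ) (i : Fin d) :
    (facePoly t i - X i ^ 2).totalDegree ≤ 1 := by
  have h : facePoly t i - X i ^ 2 = C (-2 * t) * X i + C (t ^ 2 - 1) := by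
    simp only [facePoly, map_mul, map_sub, map_pow, map_neg, map_one]
    rw [show (C 2 : MvPolynomial (Fin d) ℝ) = 2 from map_ofNat C 2]
    ring
  rw [h]
  refine (totalDegree_add _ _).trans (max_le ?_ ?_)
  · refine (totalDegree_mul _ _).trans ?_
    rw [totalDegree_C, totalDegree_X]
  · rw [totalDegree_C]
    exact zero_le_one

lemma totalDegree_facePoly (t : ℝ) (i : Fin d) : (facePoly t i).totalDegree ≤ 2 := by
  have h : facePoly t i = (facePoly t i - X i ^ 2) + X i ^ 2 := by ring
  rw [h]
  refine (totalDegree_add _ _).trans (max_le ((totalDegree_facePoly_sub t i).trans (by simp)) ?_)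
  rw [totalDegree_X_pow]

lemma totalDegree_facePoly_pow_sub (t : ℝ) (i : Fin d) {s : ℕ} (hs : 1 ≤ s) :
    (facePoly t i ^ s - X i ^ (2 * s)).totalDegree < 2 * s := by
  induction s, hs using Nat.le_induction with
  | base => simpa [Nat.lt_succ_iff] using totalDegree_facePoly_sub t i
  | succ s hs ih =>
    have h : facePoly t i ^ (s + 1) - X i ^ (2 * (s + 1)) =
        facePoly t i * (facePoly t i ^ s - X i ^ (2 * s)) +
          X i ^ (2 * s) * (facePoly t i - X i ^ 2) := by ring
    rw [h]
    refine (totalDegree_add _ _).trans_lt (max_lt ?_ ?_)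
    · have := totalDegree_mul (facePoly t i) (facePoly t i ^ s - X i ^ (2 * s))
      have := totalDegree_facePoly t i
      omega
    · have := totalDegree_mul (X i ^ (2 * s)) (facePoly t i - X i ^ 2)
      have := totalDegree_facePoly_sub t i
      rw [totalDegree_X_pow] at *
      omega

/-- The operator `p ↦ ∂ᵢ^r (((Xᵢ - t)² - 1)^r ∂ᵢ^r p)`: the Sturm-Liouville operator of order `2 r`
for the Legendre polynomials, acting in the `i`-th variable. -/
noncomputable def legendreOp (r : ℕ) (t : ℝ) (i : Fin d) :
    MvPolynomial (Fin d) ℝ →ₗ[ℝ] MvPolynomial (Fin d) ℝ :=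
  ((pderiv i).toLinearMap ^ r) ∘ₗ LinearMap.mulLeft ℝ (facePoly t i ^ r) ∘ₗ
    ((pderiv i).toLinearMap ^ r)

lemma legendreOp_apply (r : ℕ) (t : ℝ) (i : Fin d) (p : MvPolynomial (Fin d) ℝ) :
    legendreOp r t i p = (pderiv i)^[r] (facePoly t i ^ r * (pderiv i)^[r] p) := by
  simp [legendreOp, Module.End.pow_apply]

/-- The eigenvalue of the Legendre operator of order `2 r` on polynomials of degree `n`: it is
`(n + r)! / (n - r)!` for `r ≤ n` and zero otherwise. -/
def legendreEigen (r n : ℕ) : ℕ := n.descFactorial r * (n + r).descFactorial r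

/-- The Legendre operator is triangular: it multiplies top degree coefficients by its
eigenvalues. -/
lemma coeff_legendreOp {r : ℕ} (hr : 1 ≤ r) (t : ℝ) (i : Fin d) {p : MvPolynomial (Fin d) ℝ}
    {b : Fin d →₀ ℕ} (hb : p.totalDegree ≤ b.degree) :
    coeff b (legendreOp r t i p) = legendreEigen r (b i) * coeff b p := by
  rw [legendreOp_apply, coeff_iterate_pderiv]
  have h : coeff (b + Finsupp.single i r) (facePoly t i ^ r * (pderiv i)^[r] p) =
      coeff b p * ((b i).descFactorial r : ℕ) := by
    have h1 : facePoly t i ^ r * (pderiv i)^[r] p = X i ^ (2 * r) * (pderiv i)^[r] p +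
        (facePoly t i ^ r - X i ^ (2 * r)) * (pderiv i)^[r] p := by ring
    have h2 : coeff (b + Finsupp.single i r)
        ((facePoly t i ^ r - X i ^ (2 * r)) * (pderiv i)^[r] p) = 0 := by
      by_cases h0 : (pderiv i)^[r] p = 0
      · rw [h0]; simp
      refine coeff_eq_zero_of_totalDegree_lt ?_
      have h3 := totalDegree_mul (facePoly t i ^ r - X i ^ (2 * r)) ((pderiv i)^[r] p)
      have h4 := totalDegree_facePoly_pow_sub t i hr
      have h5 := totalDegree_iterate_pderiv i r h0
      have h6 : (b + Finsupp.single i r).degree = b.degree + r := by simp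
      rw [← Finsupp.degree_apply, h6]
      omega
    rw [h1, coeff_add, h2, add_zero, X_pow_eq_monomial, coeff_monomial_mul', one_mul]
    split_ifs with hle
    · have h7 : r ≤ b i := by
        have := hle i
        simp at this
        omega
      have h8 : b + Finsupp.single i r - Finsupp.single i (2 * r) + Finsupp.single i r = b := by
        ext j
        by_cases hj : i = j
        · subst hj; simp; omega
        · simp [hj]
      rw [coeff_iterate_pderiv, h8]
      congr 3
      simp; omega
    · have h7 : b i < r := by
        by_contra hcon
        refine hle fun j => ?_
        by_cases hj : i = j
        · subst hj; simp; omega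
        · simp [hj]
      rw [Nat.descFactorial_of_lt h7]; simp
  rw [h, legendreEigen]
  push_cast
  ring

/-- Above the degree of `p`, the triangular form leaves only zero coefficients. -/
lemma totalDegree_legendreOp_le {r : ℕ} (hr : 1 ≤ r) (t : ℝ) (i : Fin d)
    (p : MvPolynomial (Fin d) ℝ) : (legendreOp r t i p).totalDegree ≤ p.totalDegree := by
  by_contra! hlt
  have h0 : legendreOp r t i p ≠ 0 := by
    rintro h; rw [h] at hlt; simp at hlt
  obtain ⟨b, hb, hdeg⟩ := exists_degree_eq_totalDegree h0
  have hdeg' : (legendreOp r t i p).totalDegree = b.degree := hdeg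
  rw [mem_support_iff, coeff_legendreOp hr t i (by omega)] at hb
  refine right_ne_zero_of_mul hb (coeff_eq_zero_of_totalDegree_lt ?_)
  rw [← Finsupp.degree_apply]
  omega

/-- Growth of the eigenvalues of the Legendre operator. -/
lemma le_legendreEigen {r n : ℕ} (hr : 1 ≤ r) (hn : r ≤ n) :
    ((n : ℝ) / r) ^ (2 * r) ≤ legendreEigen r n := by
  have hr' : (0 : ℝ) < r := by exact_mod_cast hr
  have h1 : ((n : ℝ) / r) ^ r ≤ (n.descFactorial r : ℕ) := by
    refine le_trans ?_ (Nat.cast_le.2 (Nat.pow_sub_le_descFactorial n r))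
    push_cast [show r ≤ n + 1 by omega]
    refine pow_le_pow_left₀ (by positivity) ?_ r
    rw [div_le_iff₀ hr']
    have h2 : (1 : ℝ) ≤ r := by exact_mod_cast hr
    have h3 : (r : ℝ) ≤ n := by exact_mod_cast hn
    nlinarith [mul_nonneg (sub_nonneg.2 h2) (sub_nonneg.2 h3)]
  have h2 : ((n : ℝ) / r) ^ r ≤ ((n + r).descFactorial r : ℕ) := by
    refine le_trans ?_ (Nat.cast_le.2 (Nat.pow_sub_le_descFactorial (n + r) r))
    push_cast [show r ≤ n + r + 1 by omega]
    refine pow_le_pow_left₀ (by positivity) ?_ r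
    have : (1 : ℝ) ≤ r := by exact_mod_cast hr
    have := div_le_self (Nat.cast_nonneg (α := ℝ) n) this
    linarith
  rw [two_mul, pow_add, legendreEigen, Nat.cast_mul]
  gcongr

/-- The sum of the Legendre operators in the individual variables. -/
noncomputable def legendreSum (r : ℕ) (t : ℝ) :
    MvPolynomial (Fin d) ℝ →ₗ[ℝ] MvPolynomial (Fin d) ℝ := ∑ i, legendreOp r t i

lemma totalDegree_legendreSum_le {r : ℕ} (hr : 1 ≤ r) (t : ℝ) (p : MvPolynomial (Fin d) ℝ) :
    (legendreSum r t p).totalDegree ≤ p.totalDegree := by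
  rw [legendreSum, LinearMap.sum_apply]
  exact totalDegree_finsetSum_le fun i _ => totalDegree_legendreOp_le hr t i p

/-- An eigenvector of degree more than `k` has an eigenvalue of order at least `k ^ (2 r)`: the
eigenvalue is read off a coefficient of top degree, one exponent of which is at least `k / d`. -/
lemma le_eigenvalue_legendreSum {r k : ℕ} (hr : 1 ≤ r) (hd : 0 < d) (hk : d * r ≤ k) (t : ℝ)
    {p : MvPolynomial (Fin d) ℝ} (hp : k < p.totalDegree) {c : ℝ}
    (hc : legendreSum r t p = c • p) : ((k : ℝ) / (d * r)) ^ (2 * r) ≤ c := by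
  have h0 : p ≠ 0 := by rintro rfl; simp at hp
  obtain ⟨b, hb, hdeg⟩ := exists_degree_eq_totalDegree h0
  have hdeg' : p.totalDegree = b.degree := hdeg
  rw [mem_support_iff] at hb
  have h1 := congrArg (coeff b) hc
  rw [legendreSum, LinearMap.sum_apply, coeff_sum, coeff_smul, smul_eq_mul,
    Finset.sum_congr rfl fun i _ => coeff_legendreOp hr t i hdeg'.le, ← Finset.sum_mul] at h1
  rw [← mul_right_cancel₀ hb h1]
  obtain ⟨i, hi⟩ : ∃ i, k ≤ d * b i := by
    by_contra! hcon
    have h2 : d * b.degree ≤ ∑ _i : Fin d, k := by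
      rw [Finsupp.degree_eq_sum, Finset.mul_sum]
      exact Finset.sum_le_sum fun i _ => (hcon i).le
    rw [Finset.sum_const, Finset.card_univ, Fintype.card_fin, smul_eq_mul] at h2
    have := Nat.le_of_mul_le_mul_left h2 hd
    omega
  have hri : r ≤ b i := Nat.le_of_mul_le_mul_left (hk.trans hi) hd
  have hd' : (0 : ℝ) < d := by exact_mod_cast hd
  have hr' : (0 : ℝ) < r := by exact_mod_cast hr
  calc ((k : ℝ) / (d * r)) ^ (2 * r) ≤ ((b i : ℝ) / r) ^ (2 * r) := by
        refine pow_le_pow_left₀ (by positivity) ?_ _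
        rw [div_le_div_iff₀ (by positivity) hr']
        have : (k : ℝ) ≤ d * b i := by exact_mod_cast hi
        nlinarith
    _ ≤ legendreEigen r (b i) := le_legendreEigen hr hri
    _ ≤ ∑ i, (legendreEigen r (b i) : ℝ) :=
        Finset.single_le_sum (f := fun i => (legendreEigen r (b i) : ℝ))
          (fun _ _ => Nat.cast_nonneg _) (Finset.mem_univ i)

/-- If `q ^ n` divides `p`, each derivative lowers the exponent by at most one. -/
lemma pow_dvd_iterate_pderiv (i : Fin d) {q : MvPolynomial (Fin d) ℝ} (n m : ℕ)
    {p : MvPolynomial (Fin d) ℝ} (h : q ^ (n + m) ∣ p) : q ^ n ∣ (pderiv i)^[m] p := by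
  induction m generalizing p with
  | zero => exact h
  | succ m ih =>
    rw [Function.iterate_succ_apply]
    refine ih ?_
    obtain ⟨w, rfl⟩ := h
    rw [pderiv_mul, pderiv_pow, ← add_assoc]
    refine dvd_add ?_ ?_
    · exact Dvd.intro_left (((n + m + 1 : ℕ) : MvPolynomial (Fin d) ℝ) * pderiv i q * w)
        (by rw [Nat.add_sub_cancel]; ring)
    · exact (pow_dvd_pow q (Nat.le_succ _)).mul_right _

/-! ### Inverting a symmetric operator -/

/-- A symmetric operator on a finite-dimensional space with all eigenvalues at least `c > 0` is
invertible, and its inverse is bounded by `c⁻¹` as a quadratic form. The inner product is pulled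
back along the injective map `Φ`. -/
lemma exists_preimage_of_le_eigenvalues {H M : Type*} [NormedAddCommGroup H]
    [InnerProductSpace ℝ H] [AddCommGroup M] [Module ℝ M] [FiniteDimensional ℝ M] (Φ : M →ₗ[ℝ] H)
    (hΦ : Function.Injective Φ) (E : M →ₗ[ℝ] M)
    (hE : ∀ p q, inner ℝ (Φ (E p)) (Φ q) = inner ℝ (Φ p) (Φ (E q))) {c : ℝ} (hc : 0 < c)
    (heig : ∀ (μ : ℝ) (p : M), p ≠ 0 → E p = μ • p → c ≤ μ) (p : M) :
    ∃ w, E w = p ∧ inner ℝ (Φ p) (Φ w) ≤ c⁻¹ * ‖Φ p‖ ^ 2 := by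
  let e := LinearEquiv.ofInjective Φ hΦ
  have he (x : M) : ((e x : LinearMap.range Φ) : H) = Φ x := rfl
  have : FiniteDimensional ℝ (LinearMap.range Φ) := inferInstance
  let F : LinearMap.range Φ →ₗ[ℝ] LinearMap.range Φ := e.toLinearMap ∘ₗ E ∘ₗ e.symm.toLinearMap
  have hF : F.IsSymmetric := by
    intro x y
    obtain ⟨x, rfl⟩ := e.surjective x
    obtain ⟨y, rfl⟩ := e.surjective y
    simpa [F, Submodule.coe_inner, he] using hE x y
  let B := hF.eigenvectorBasis rfl
  let ev := hF.eigenvalues rfl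
  have hev (j) : c ≤ ev j := by
    refine heig _ (e.symm (B j)) ?_ ?_
    · simpa using B.toBasis.ne_zero j
    · apply e.injective
      have h := hF.apply_eigenvectorBasis rfl j
      rw [LinearEquiv.map_smul, e.apply_symm_apply]
      exact h
  let w := ∑ j, ((ev j)⁻¹ * inner ℝ (B j) (e p)) • B j
  have hw : F w = e p := by
    rw [map_sum]
    conv_rhs => rw [← B.sum_repr' (e p)]
    refine Finset.sum_congr rfl fun j _ => ?_
    have h : F (B j) = ev j • B j := hF.apply_eigenvectorBasis rfl j
    have h0 : ev j ≠ 0 := (hc.trans_le (hev j)).ne'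
    rw [map_smul, h, smul_smul]
    congr 1
    field_simp
  refine ⟨e.symm w, ?_, ?_⟩
  · apply e.injective
    simpa [F] using hw
  · have h1 : inner ℝ (Φ p) (Φ (e.symm w)) = ∑ j, (ev j)⁻¹ * inner ℝ (B j) (e p) ^ 2 := by
      rw [← he, ← he, e.apply_symm_apply, ← Submodule.coe_inner, inner_sum]
      refine Finset.sum_congr rfl fun j _ => ?_
      rw [inner_smul_right, real_inner_comm (B j)]
      ring
    have h2 : ‖Φ p‖ ^ 2 = ∑ j, inner ℝ (B j) (e p) ^ 2 := by
      rw [← he, ← Submodule.coe_norm, ← B.sum_sq_norm_inner_right (e p)]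
      simp
    rw [h1, h2, Finset.mul_sum]
    refine Finset.sum_le_sum fun j _ => ?_
    have := inv_anti₀ hc (hev j)
    gcongr

end Legendre

namespace GOT
open MvPolynomial (eval pderiv)
open Legendre
open Filter Topology

variable {d : ℕ}

/-! ### Partial derivatives and weak derivatives -/

lemma continuous_eval_poly (p : MvPolynomial (Fin d) ℝ) : Continuous fun y => eval y p :=
  MvPolynomial.continuous_eval p

lemma contDiff_eval_poly (p : MvPolynomial (Fin d) ℝ) : ContDiff ℝ ∞ fun y => eval y p := by
  have h : AnalyticOnNhd ℝ (fun y : Fin d → ℝ => eval y p) Set.univ :=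
    AnalyticOnNhd.eval_mvPolynomial p
  exact h.contDiff

lemma contDiff_partialDeriv (i : Fin d) {f : (Fin d → ℝ) → ℝ} (hf : ContDiff ℝ ∞ f) :
    ContDiff ℝ ∞ (partialDeriv i f) :=
  (hf.fderiv_right (m := ∞) (by simp)).clm_apply contDiff_const

lemma differentiable_of_smooth {f : (Fin d → ℝ) → ℝ} (hf : ContDiff ℝ ∞ f) :
    Differentiable ℝ f := hf.differentiable (by simp)

lemma partialDeriv_mul (i : Fin d) {f g : (Fin d → ℝ) → ℝ} (hf : Differentiable ℝ f)
    (hg : Differentiable ℝ g) (x : Fin d → ℝ) :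
    partialDeriv i (fun y => f y * g y) x =
      partialDeriv i f x * g x + f x * partialDeriv i g x := by
  simp only [partialDeriv]
  rw [fderiv_fun_mul (hf x) (hg x)]
  simp
  ring

lemma partialDeriv_eval (i : Fin d) (p : MvPolynomial (Fin d) ℝ) :
    partialDeriv i (fun y => eval y p) = fun y => eval y (pderiv i p) := by
  have hd (q : MvPolynomial (Fin d) ℝ) : Differentiable ℝ fun y => eval y q :=
    differentiable_of_smooth (contDiff_eval_poly q)
  funext x
  induction p using MvPolynomial.induction_on with
  | C a => simp [partialDeriv]
  | add p q hp hq =>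
    have h : partialDeriv i (fun y => eval y (p + q)) x =
        partialDeriv i (fun y => eval y p) x + partialDeriv i (fun y => eval y q) x := by
      simp only [partialDeriv, map_add]
      rw [fderiv_fun_add (hd p x) (hd q x)]
      rfl
    rw [h, hp, hq, map_add, map_add]
  | mul_X p j hp =>
    have h := partialDeriv_mul i (hd p) (hd (MvPolynomial.X j)) x
    simp only [← map_mul] at h
    rw [h, hp, MvPolynomial.pderiv_mul, map_add, map_mul, map_mul]
    congr 2
    simp only [partialDeriv, MvPolynomial.eval_X]
    have h1 : HasFDerivAt (fun y : Fin d → ℝ => y j)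
        (ContinuousLinearMap.proj (R := ℝ) (φ := fun _ : Fin d => ℝ) j) x :=
      hasFDerivAt_apply j x
    rw [h1.fderiv]
    by_cases hij : j = i
    · subst hij; simp
    · simp [MvPolynomial.pderiv_X_of_ne hij, hij]

lemma multiDeriv_single (i : Fin d) (n : ℕ) (f : (Fin d → ℝ) → ℝ) :
    multiDeriv (Pi.single i n) f = (partialDeriv i)^[n] f := by
  have h (L : List (Fin d)) (hL : L.Nodup) :
      L.foldr (fun j g => (partialDeriv j)^[(Pi.single i n : Fin d → ℕ) j] g) f =
        if i ∈ L then (partialDeriv i)^[n] f else f := by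
    induction L with
    | nil => simp
    | cons j L ih =>
      rw [List.nodup_cons] at hL
      rw [List.foldr_cons, ih hL.2]
      by_cases hj : i = j
      · subst hj; simp [hL.1]
      · simp [hj, Ne.symm hj]
  rw [multiDeriv, h _ (List.nodup_finRange d), if_pos (List.mem_finRange i)]

/-- `g` is a weak derivative of `f` in the `i`-th coordinate on `Ω`. -/
def HasWeakPartial (Ω : Set (Fin d → ℝ)) (i : Fin d) (f g : (Fin d → ℝ) → ℝ) : Prop :=
  ∀ φ : (Fin d → ℝ) → ℝ, ContDiff ℝ ∞ φ → HasCompactSupport φ → tsupport φ ⊆ Ω →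
    ∫ y in Ω, f y * partialDeriv i φ y = -∫ y in Ω, g y * φ y

lemma isWeakDeriv_zero (Ω : Set (Fin d → ℝ)) (f : (Fin d → ℝ) → ℝ) : IsWeakDeriv Ω 0 f f := by
  intro φ _ _ _
  have h : multiDeriv 0 φ = φ := by
    simp only [multiDeriv, Pi.zero_apply, Function.iterate_zero, id]
    induction List.finRange d with
    | nil => rfl
    | cons j L ih => exact ih
  simp [h]

/-- Weak derivatives of consecutive orders in one coordinate are weak derivatives of each other. -/
lemma IsWeakDeriv.hasWeakPartial {Ω : Set (Fin d → ℝ)} {i : Fin d} {n : ℕ}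
    {f g h : (Fin d → ℝ) → ℝ} (hg : IsWeakDeriv Ω (Pi.single i n) f g)
    (hh : IsWeakDeriv Ω (Pi.single i (n + 1)) f h) : HasWeakPartial Ω i g h := by
  intro φ hφ hc hs
  have h1 := hg (partialDeriv i φ) (contDiff_partialDeriv i hφ) (hc.fderiv_apply ℝ _)
    ((tsupport_fderiv_apply_subset ℝ _).trans hs)
  have h2 := hh φ hφ hc hs
  rw [multiDeriv_single, Finset.sum_pi_single' ] at h1 h2
  rw [Function.iterate_succ_apply, h1] at h2
  simp only [Finset.mem_univ, if_true, pow_succ] at h2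
  have h3 : ((-1 : ℝ) ^ n) ≠ 0 := by positivity
  apply mul_left_cancel₀ h3
  rw [h2]; ring

lemma hasWeakPartial_eval {Ω : Set (Fin d → ℝ)} (i : Fin d) (q : MvPolynomial (Fin d) ℝ) :
    HasWeakPartial Ω i (fun y => eval y q) (fun y => eval y (pderiv i q)) := by
  intro φ hφ hc hs
  have hφ0 (x) (hx : x ∉ Ω) : φ x = 0 := image_eq_zero_of_notMem_tsupport fun h => hx (hs h)
  have hφ1 (x) (hx : x ∉ Ω) : partialDeriv i φ x = 0 :=
    image_eq_zero_of_notMem_tsupport (f := partialDeriv i φ)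
      fun h => hx (hs (tsupport_fderiv_apply_subset ℝ _ h))
  have hc' : HasCompactSupport (partialDeriv i φ) := hc.fderiv_apply ℝ _
  have hcont' := (contDiff_partialDeriv i hφ).continuous
  rw [setIntegral_eq_integral_of_forall_compl_eq_zero fun x hx => by rw [hφ1 x hx, mul_zero],
    setIntegral_eq_integral_of_forall_compl_eq_zero fun x hx => by rw [hφ0 x hx, mul_zero]]
  have hq (x) : eval x (pderiv i q) = fderiv ℝ (fun y => eval y q) x (Pi.single i 1) :=
    (congrFun (partialDeriv_eval i q) x).symm
  simp only [hq]
  refine integral_mul_fderiv_eq_neg_fderiv_mul_of_integrable ?_ ?_ ?_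
    (fun x _ => differentiable_of_smooth (contDiff_eval_poly q) x)
    (fun x _ => differentiable_of_smooth hφ x)
  · simp only [← hq]
    exact ((continuous_eval_poly _).mul hφ.continuous).integrable_of_hasCompactSupport hc.mul_left
  · exact ((continuous_eval_poly _).mul hcont').integrable_of_hasCompactSupport hc'.mul_left
  · exact ((continuous_eval_poly _).mul hφ.continuous).integrable_of_hasCompactSupport hc.mul_left

/-! ### Cutoff functions on a cube -/

/-- A smooth function which is `0` on `(-∞, 1]` and `1` on `[2, ∞)`. -/
noncomputable def step (s : ℝ) : ℝ := Real.smoothTransition (s - 1)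

lemma contDiff_step : ContDiff ℝ ∞ step :=
  Real.smoothTransition.contDiff.comp (contDiff_id.sub contDiff_const)

lemma step_nonneg (s : ℝ) : 0 ≤ step s := Real.smoothTransition.nonneg _

lemma step_le_one (s : ℝ) : step s ≤ 1 := Real.smoothTransition.le_one _

lemma step_of_le_one {s : ℝ} (hs : s ≤ 1) : step s = 0 :=
  Real.smoothTransition.zero_of_nonpos (by linarith)

lemma step_of_two_le {s : ℝ} (hs : 2 ≤ s) : step s = 1 :=
  Real.smoothTransition.one_of_one_le (by linarith)

lemma deriv_step_of_lt_one {s : ℝ} (hs : s < 1) : deriv step s = 0 := by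
  have h : step =ᶠ[𝓝 s] fun _ => 0 := by
    filter_upwards [Iio_mem_nhds hs] with y hy using step_of_le_one (le_of_lt hy)
  rw [h.deriv_eq, deriv_const]

lemma deriv_step_of_two_lt {s : ℝ} (hs : 2 < s) : deriv step s = 0 := by
  have h : step =ᶠ[𝓝 s] fun _ => 1 := by
    filter_upwards [Ioi_mem_nhds hs] with y hy using step_of_two_le (le_of_lt hy)
  rw [h.deriv_eq, deriv_const]

lemma exists_bound_mul_deriv_step : ∃ B : ℝ, ∀ s, |s * deriv step s| ≤ B := by
  have hc : Continuous fun s : ℝ => s * deriv step s :=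
    continuous_id.mul (contDiff_step.continuous_deriv (by simp))
  obtain ⟨B, hB⟩ := (isCompact_Icc (a := (1 : ℝ)) (b := 2)).exists_bound_of_continuousOn
    hc.continuousOn
  refine ⟨max B 0, fun s => ?_⟩
  rcases lt_or_ge s 1 with h | h
  · simp [deriv_step_of_lt_one h]
  rcases lt_or_ge 2 s with h' | h'
  · simp [deriv_step_of_two_lt h']
  · exact (hB s ⟨h, h'⟩).trans (le_max_left _ _)

/-- A cutoff function which vanishes near the boundary of the cube of centre `t` and
tends to `1` on the open cube as `n → ∞`. -/
noncomputable def cutoff (t : ℝ) (n : ℕ) (x : Fin d → ℝ) : ℝ :=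
  ∏ j, step (n * (1 - (x j - t) ^ 2))

lemma contDiff_cutoff (t : ℝ) (n : ℕ) : ContDiff ℝ ∞ (cutoff (d := d) t n) :=
  contDiff_prod fun j _ => contDiff_step.comp
    (contDiff_const.mul (contDiff_const.sub (((contDiff_apply ℝ ℝ j).sub contDiff_const).pow 2)))

lemma cutoff_nonneg (t : ℝ) (n : ℕ) (x : Fin d → ℝ) : 0 ≤ cutoff t n x :=
  Finset.prod_nonneg fun _ _ => step_nonneg _

lemma cutoff_le_one (t : ℝ) (n : ℕ) (x : Fin d → ℝ) : cutoff t n x ≤ 1 :=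
  Finset.prod_le_one (fun _ _ => step_nonneg _) fun _ _ => step_le_one _

lemma mem_openCube {t : ℝ} {x : Fin d → ℝ} :
    x ∈ openCube d t ↔ ∀ j, 0 < 1 - (x j - t) ^ 2 := by
  simp only [openCube, Set.mem_univ_pi, Set.mem_Ioo]
  refine forall_congr' fun j => ⟨fun h => by nlinarith, fun h => ?_⟩
  have := abs_lt.1 ((sq_lt_one_iff_abs_lt_one (x j - t)).1 (by linarith))
  constructor <;> linarith

lemma openCube_subset_cube (t : ℝ) : openCube d t ⊆ cube d t := fun _ hx =>
  ⟨fun j => (hx j trivial).1.le, fun j => (hx j trivial).2.le⟩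

lemma isOpen_openCube (t : ℝ) : IsOpen (openCube d t) :=
  isOpen_set_pi Set.finite_univ fun _ _ => isOpen_Ioo

lemma measurableSet_openCube (t : ℝ) : MeasurableSet (openCube d t) :=
  (isOpen_openCube t).measurableSet

lemma isCompact_cube (t : ℝ) : IsCompact (cube d t) := isCompact_Icc

lemma tsupport_cutoff_subset (t : ℝ) {n : ℕ} (hn : 0 < n) :
    tsupport (cutoff (d := d) t n) ⊆ openCube d t := by
  have hn' : (0 : ℝ) < n := by exact_mod_cast hn
  have hcl : IsClosed {x : Fin d → ℝ | ∀ j, 1 ≤ n * (1 - (x j - t) ^ 2)} := by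
    simp only [Set.ofPred_forall]
    exact isClosed_iInter fun j => isClosed_le (by fun_prop) (by fun_prop)
  refine (closure_minimal (fun x hx j => ?_) hcl).trans fun x hx => mem_openCube.2 fun j => ?_
  · by_contra! hcon
    exact hx (Finset.prod_eq_zero (Finset.mem_univ j) (step_of_le_one hcon.le))
  · have := hx j
    by_contra! hcon
    nlinarith

lemma hasCompactSupport_cutoff (t : ℝ) {n : ℕ} (hn : 0 < n) :
    HasCompactSupport (cutoff (d := d) t n) :=
  (isCompact_cube t).of_isClosed_subset (isClosed_tsupport _)
    ((tsupport_cutoff_subset t hn).trans (openCube_subset_cube t))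

lemma partialDeriv_cutoff (t : ℝ) (n : ℕ) (i : Fin d) (x : Fin d → ℝ) :
    partialDeriv i (cutoff t n) x =
      deriv step (n * (1 - (x i - t) ^ 2)) * (n * (-(2 * (x i - t)))) *
        ∏ j ∈ Finset.univ.erase i, step (n * (1 - (x j - t) ^ 2)) := by
  have h0 : partialDeriv i (cutoff t n) x = lineDeriv ℝ (cutoff t n) x (Pi.single i 1) :=
    ((differentiable_of_smooth (contDiff_cutoff t n) x).lineDeriv_eq_fderiv).symm
  have h1 : (fun s : ℝ => cutoff t n (x + s • Pi.single i 1)) = fun s =>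
      step (n * (1 - (x i + s - t) ^ 2)) *
        ∏ j ∈ Finset.univ.erase i, step (n * (1 - (x j - t) ^ 2)) := by
    funext s
    rw [cutoff, ← Finset.mul_prod_erase _ _ (Finset.mem_univ i)]
    congr 1
    · simp
    · refine Finset.prod_congr rfl fun j hj => ?_
      simp [Finset.ne_of_mem_erase hj]
  have h2 : HasDerivAt (fun s : ℝ => n * (1 - (x i + s - t) ^ 2)) (n * (-(2 * (x i - t)))) 0 := by
    have h := ((((hasDerivAt_id' (0 : ℝ)).const_add (x i)).sub_const t).fun_pow 2).const_sub 1
      |>.const_mul (n : ℝ)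
    exact h.congr_deriv (by norm_num)
  have h3 : HasDerivAt step (deriv step (n * (1 - (x i + 0 - t) ^ 2)))
      (n * (1 - (x i + 0 - t) ^ 2)) :=
    (contDiff_step.differentiable (by simp) _).hasDerivAt
  have h4 := (HasDerivAt.comp (h₂ := step) 0 h3 h2).mul_const
    (∏ j ∈ Finset.univ.erase i, step (n * (1 - (x j - t) ^ 2)))
  rw [h0, lineDeriv, h1]
  refine h4.deriv.trans ?_
  rw [add_zero]

/-- Although the derivatives of the cutoff functions blow up, their products with a function
vanishing on the faces orthogonal to the direction of derivation stay bounded. -/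
lemma exists_bound_partialDeriv_cutoff (t : ℝ) (i : Fin d) : ∃ B : ℝ, ∀ n, ∀ x ∈ openCube d t,
    |(1 - (x i - t) ^ 2) * partialDeriv i (cutoff t n) x| ≤ B := by
  obtain ⟨B, hB⟩ := exists_bound_mul_deriv_step
  refine ⟨B * 2, fun n x hx => ?_⟩
  set P := ∏ j ∈ Finset.univ.erase i, step (n * (1 - (x j - t) ^ 2)) with hP
  have hP1 : |P| ≤ 1 := abs_le.2
    ⟨by linarith [show 0 ≤ P from Finset.prod_nonneg fun _ _ => step_nonneg _],
      Finset.prod_le_one (fun _ _ => step_nonneg _) fun _ _ => step_le_one _⟩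
  have h1 : (1 - (x i - t) ^ 2) * partialDeriv i (cutoff t n) x =
      ((n * (1 - (x i - t) ^ 2)) * deriv step (n * (1 - (x i - t) ^ 2))) *
        (-(2 * (x i - t))) * P := by
    rw [partialDeriv_cutoff]; ring
  have h2 : |-(2 * (x i - t))| ≤ 2 := by
    have h := mem_openCube.1 hx i
    have := (sq_lt_one_iff_abs_lt_one (x i - t)).1 (by linarith)
    rw [abs_neg, abs_mul, abs_two]; linarith
  rw [h1, abs_mul, abs_mul]
  calc _ ≤ B * 2 * 1 := by
        have h0 := (abs_nonneg _).trans (hB (n * (1 - (x i - t) ^ 2)))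
        gcongr
        exact hB _
    _ = B * 2 := mul_one _

lemma eventually_cutoff (t : ℝ) {x : Fin d → ℝ} (hx : x ∈ openCube d t) : ∀ᶠ n : ℕ in atTop,
    cutoff t n x = 1 ∧ ∀ i, partialDeriv i (cutoff t n) x = 0 := by
  have h : ∀ᶠ n : ℕ in atTop, ∀ j, 2 < n * (1 - (x j - t) ^ 2) :=
    eventually_all.2 fun j => (tendsto_natCast_atTop_atTop.atTop_mul_const
      (mem_openCube.1 hx j)).eventually_gt_atTop 2
  filter_upwards [h] with n hn
  refine ⟨Finset.prod_eq_one fun j _ => step_of_two_le (hn j).le, fun i => ?_⟩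
  rw [partialDeriv_cutoff, deriv_step_of_two_lt (hn i)]
  ring

/-! ### Integration by parts against polynomials vanishing on opposite faces -/

lemma eval_facePoly (t : ℝ) (i : Fin d) (x : Fin d → ℝ) :
    eval x (facePoly t i) = (x i - t) ^ 2 - 1 := by
  simp [facePoly]

/-- The defining identity of a weak derivative in the `i`-th coordinate extends from test functions
to polynomials that vanish on the faces of the cube orthogonal to the `i`-th axis. -/
lemma HasWeakPartial.integral_mul_pderiv {t : ℝ} {i : Fin d} {f g : (Fin d → ℝ) → ℝ}
    (h : HasWeakPartial (openCube d t) i f g) (hf : IntegrableOn f (openCube d t))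
    (hg : IntegrableOn g (openCube d t)) {v : MvPolynomial (Fin d) ℝ} (hv : facePoly t i ∣ v) :
    ∫ y in openCube d t, f y * eval y (pderiv i v) = -∫ y in openCube d t, g y * eval y v := by
  obtain ⟨w, rfl⟩ := hv
  set v := facePoly t i * w with hv
  have hbound (q : MvPolynomial (Fin d) ℝ) : ∃ M, ∀ x ∈ openCube d t, |eval x q| ≤ M := by
    obtain ⟨M, hM⟩ := (isCompact_cube (d := d) t).exists_bound_of_continuousOn
      (continuous_eval_poly q).continuousOn
    exact ⟨M, fun x hx => hM x (openCube_subset_cube t hx)⟩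
  obtain ⟨M₀, hM₀⟩ := hbound v
  obtain ⟨M₁, hM₁⟩ := hbound (pderiv i v)
  obtain ⟨M₂, hM₂⟩ := hbound w
  obtain ⟨B, hB⟩ := exists_bound_partialDeriv_cutoff t i
  have habs (n x) : |cutoff (d := d) t n x| ≤ 1 := by
    rw [abs_of_nonneg (cutoff_nonneg t n x)]; exact cutoff_le_one t n x
  let φ (n : ℕ) (x : Fin d → ℝ) : ℝ := eval x v * cutoff t n x
  have hφ (n) : ContDiff ℝ ∞ (φ n) := (contDiff_eval_poly v).mul (contDiff_cutoff t n)
  have hdφ (n x) : partialDeriv i (φ n) x =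
      eval x (pderiv i v) * cutoff t n x + eval x v * partialDeriv i (cutoff t n) x := by
    rw [← congrFun (partialDeriv_eval i v) x]
    exact partialDeriv_mul i (differentiable_of_smooth (contDiff_eval_poly v))
      (differentiable_of_smooth (contDiff_cutoff t n)) x
  have hL : Tendsto (fun n => ∫ y in openCube d t, f y * partialDeriv i (φ n) y) atTop
      (𝓝 (∫ y in openCube d t, f y * eval y (pderiv i v))) := by
    refine tendsto_integral_of_dominated_convergence (fun y => |f y| * (M₁ + M₂ * B))
      (fun n => hf.aestronglyMeasurable.mul
        (contDiff_partialDeriv i (hφ n)).continuous.aestronglyMeasurable)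
      (hf.abs.mul_const _) (fun n => ?_) ?_
    · filter_upwards [ae_restrict_mem (measurableSet_openCube t)] with x hx
      rw [Real.norm_eq_abs, abs_mul]
      refine mul_le_mul_of_nonneg_left ?_ (abs_nonneg _)
      rw [hdφ]
      refine (abs_add_le _ _).trans (add_le_add ?_ ?_)
      · rw [abs_mul]
        exact (mul_le_of_le_one_right (abs_nonneg _) (habs n x)).trans (hM₁ x hx)
      · have h1 : eval x v * partialDeriv i (cutoff t n) x =
            -(eval x w * ((1 - (x i - t) ^ 2) * partialDeriv i (cutoff t n) x)) := by
          rw [hv, map_mul, eval_facePoly]; ring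
        rw [h1, abs_neg, abs_mul]
        exact mul_le_mul (hM₂ x hx) (hB n x hx) (abs_nonneg _)
          ((abs_nonneg _).trans (hM₂ x hx))
    · filter_upwards [ae_restrict_mem (measurableSet_openCube t)] with x hx
      refine tendsto_const_nhds.congr' ?_
      filter_upwards [eventually_cutoff t hx] with n hn
      rw [hdφ, hn.1, hn.2 i, mul_one, mul_zero, add_zero]
  have hR : Tendsto (fun n => ∫ y in openCube d t, g y * φ n y) atTop
      (𝓝 (∫ y in openCube d t, g y * eval y v)) := by
    refine tendsto_integral_of_dominated_convergence (fun y => |g y| * M₀)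
      (fun n => hg.aestronglyMeasurable.mul (hφ n).continuous.aestronglyMeasurable)
      (hg.abs.mul_const _) (fun n => ?_) ?_
    · filter_upwards [ae_restrict_mem (measurableSet_openCube t)] with x hx
      rw [Real.norm_eq_abs, abs_mul]
      refine mul_le_mul_of_nonneg_left ?_ (abs_nonneg _)
      rw [abs_mul]
      exact (mul_le_of_le_one_right (abs_nonneg _) (habs n x)).trans (hM₀ x hx)
    · filter_upwards [ae_restrict_mem (measurableSet_openCube t)] with x hx
      refine tendsto_const_nhds.congr' ?_
      filter_upwards [eventually_cutoff t hx] with n hn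
      simp only [φ]
      rw [hn.1, mul_one]
  refine tendsto_nhds_unique (hL.congr' ?_) hR.neg
  filter_upwards [eventually_gt_atTop 0] with n hn
  exact h (φ n) (hφ n) (hasCompactSupport_cutoff t hn).mul_left
    ((closure_mono (Function.support_mul_subset_right _ _)).trans (tsupport_cutoff_subset t hn))

/-- Repeated integration by parts against a polynomial vanishing to order `r` on two opposite
faces. -/
lemma integral_mul_iterate_pderiv {t : ℝ} {i : Fin d} (r : ℕ) (G : ℕ → (Fin d → ℝ) → ℝ)
    (hG : ∀ n ≤ r, IntegrableOn (G n) (openCube d t))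
    (hw : ∀ n < r, HasWeakPartial (openCube d t) i (G n) (G (n + 1)))
    {v : MvPolynomial (Fin d) ℝ} (hv : facePoly t i ^ r ∣ v) :
    ∫ y in openCube d t, G 0 y * eval y ((pderiv i)^[r] v) =
      (-1) ^ r * ∫ y in openCube d t, G r y * eval y v := by
  have h (n : ℕ) (hn : n ≤ r) : ∫ y in openCube d t, G 0 y * eval y ((pderiv i)^[r] v) =
      (-1) ^ n * ∫ y in openCube d t, G n y * eval y ((pderiv i)^[r - n] v) := by
    induction n with
    | zero => simp
    | succ n ih =>
      have h1 : r - n = (r - (n + 1)) + 1 := by omega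
      have h2 : facePoly t i ∣ (pderiv i)^[r - (n + 1)] v := by
        have h3 := pow_dvd_iterate_pderiv i (q := facePoly t i) (n + 1) (r - (n + 1)) (p := v)
          (by rwa [show n + 1 + (r - (n + 1)) = r by omega])
        exact (dvd_pow_self _ (by omega)).trans h3
      rw [ih (by omega), h1, Function.iterate_succ_apply',
        (hw n (by omega)).integral_mul_pderiv (hG n (by omega)) (hG (n + 1) hn) h2, pow_succ]
      ring
  simpa using h r le_rfl

/-! ### Polynomials in `L²` of a cube -/

instance (t : ℝ) : IsFiniteMeasure (volume.restrict (openCube d t)) :=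
  isFiniteMeasure_restrict.2
    (((measure_mono (openCube_subset_cube t)).trans_lt (isCompact_cube t).measure_lt_top).ne)

lemma memLp_eval_poly (t : ℝ) (p : MvPolynomial (Fin d) ℝ) :
    MemLp (fun y => eval y p) 2 (volume.restrict (openCube d t)) := by
  obtain ⟨M, hM⟩ := (isCompact_cube (d := d) t).exists_bound_of_continuousOn
    (continuous_eval_poly p).continuousOn
  refine MemLp.of_bound (continuous_eval_poly p).aestronglyMeasurable M ?_
  filter_upwards [ae_restrict_mem (measurableSet_openCube t)] with x hx
    using hM x (openCube_subset_cube t hx)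

/-- Polynomials as elements of `L²` of the cube of centre `t`. -/
noncomputable def polyLp (t : ℝ) :
    MvPolynomial (Fin d) ℝ →ₗ[ℝ] Lp ℝ 2 (volume.restrict (openCube d t)) where
  toFun p := (memLp_eval_poly t p).toLp
  map_add' p q := by
    rw [← MemLp.toLp_add]
    exact MemLp.toLp_congr _ _ (Eventually.of_forall fun y => by simp)
  map_smul' c p := by
    rw [RingHom.id_apply, ← MemLp.toLp_const_smul]
    exact MemLp.toLp_congr _ _ (Eventually.of_forall fun y => by simp [MvPolynomial.smul_eval])

lemma inner_toLp_real {α : Type*} [MeasurableSpace α] {μ : Measure α} {f g : α → ℝ}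
    (hf : MemLp f 2 μ) (hg : MemLp g 2 μ) : inner ℝ hf.toLp hg.toLp = ∫ y, f y * g y ∂μ := by
  rw [L2.inner_def]
  refine integral_congr_ae ?_
  filter_upwards [hf.coeFn_toLp, hg.coeFn_toLp] with y h1 h2
  rw [h1, h2]
  simp [mul_comm]

lemma norm_toLp_sq_real {α : Type*} [MeasurableSpace α] {μ : Measure α} {f : α → ℝ}
    (hf : MemLp f 2 μ) : ‖hf.toLp‖ ^ 2 = ∫ y, f y ^ 2 ∂μ := by
  rw [← real_inner_self_eq_norm_sq, inner_toLp_real]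
  simp only [sq]

lemma coeFn_polyLp (t : ℝ) (p : MvPolynomial (Fin d) ℝ) :
    polyLp t p =ᵐ[volume.restrict (openCube d t)] fun y => eval y p :=
  (memLp_eval_poly t p).coeFn_toLp

lemma polyLp_injective (t : ℝ) : Function.Injective (polyLp (d := d) t) := by
  refine (injective_iff_map_eq_zero _).2 fun p hp => ?_
  have h : (fun y => eval y p) =ᵐ[volume.restrict (openCube d t)] fun _ => 0 := by
    refine (coeFn_polyLp t p).symm.trans ?_
    rw [hp]
    exact Lp.coeFn_zero ℝ 2 _
  have h2 : Set.EqOn (fun y => eval y p) (fun _ => 0) (openCube d t) :=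
    Measure.eqOn_open_of_ae_eq h (isOpen_openCube t) (continuous_eval_poly p).continuousOn
      continuousOn_const
  refine MvPolynomial.funext_set (fun _ => Set.Ioo (t - 1) (t + 1))
    (fun _ => Set.Ioo_infinite (by linarith)) fun x hx => ?_
  simpa using h2 hx

/-- Polynomials are dense in `L²` of a cube. -/
lemma exists_norm_sub_polyLp_lt (t : ℝ) (F : Lp ℝ 2 (volume.restrict (openCube d t))) {ε : ℝ}
    (hε : 0 < ε) : ∃ p : MvPolynomial (Fin d) ℝ, ‖F - polyLp t p‖ < ε := by
  obtain ⟨g, hg, hgm⟩ := (Lp.memLp F).exists_boundedContinuous_eLpNorm_sub_le (by simp)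
    (ε := ENNReal.ofReal (ε / 3)) (by simpa using hε)
  have h1 : ‖F - hgm.toLp‖ ≤ ε / 3 := by
    rw [← Lp.toLp_coeFn F (Lp.memLp F), ← MemLp.toLp_sub, Lp.norm_toLp]
    exact ENNReal.toReal_le_of_le_ofReal (by positivity) hg
  set V := ((volume.restrict (openCube d t)).real Set.univ) ^ ((2 : ℝ≥0∞).toReal)⁻¹ with hV
  have hV0 : 0 ≤ V := by positivity
  let φ : MvPolynomial (Fin d) ℝ →ₐ[ℝ] C(Fin d → ℝ, ℝ) :=
    MvPolynomial.aeval fun i => ⟨fun y => y i, continuous_apply i⟩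
  have hφ (p : MvPolynomial (Fin d) ℝ) (y) : φ p y = eval y p := by
    induction p using MvPolynomial.induction_on with
    | C a => simp [φ]
    | add p q hp hq => simp [hp, hq]
    | mul_X p j hp => rw [map_mul, map_mul, ContinuousMap.mul_apply, hp]; simp [φ]
  have hsep : φ.range.SeparatesPoints := by
    intro x y hxy
    obtain ⟨i, hi⟩ := Function.ne_iff.1 hxy
    refine ⟨φ (MvPolynomial.X i), ⟨_, ⟨MvPolynomial.X i, rfl⟩, rfl⟩, ?_⟩
    simpa [hφ] using hi
  obtain ⟨q, ⟨p, rfl⟩, hq⟩ :=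
    ContinuousMap.exists_mem_subalgebra_near_continuous_of_isCompact_of_separatesPoints hsep
      g.toContinuousMap (isCompact_cube t) (ε := ε / 3 / (V + 1)) (by positivity)
  refine ⟨p, ?_⟩
  have h2 : ‖hgm.toLp - polyLp t p‖ ≤ V * (ε / 3 / (V + 1)) := by
    refine Lp.norm_le_of_ae_bound (by positivity) ?_
    filter_upwards [Lp.coeFn_sub hgm.toLp (polyLp t p), hgm.coeFn_toLp,
      coeFn_polyLp t p, ae_restrict_mem (measurableSet_openCube t)] with y e1 e2 e3 hy
    rw [e1, Pi.sub_apply, e2, e3,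
      norm_sub_rev, ← hφ]
    exact (hq y (openCube_subset_cube t hy)).le
  have h3 : V * (ε / 3 / (V + 1)) ≤ ε / 3 := by
    rw [mul_div_assoc', div_le_iff₀ (by positivity)]
    nlinarith
  calc ‖F - polyLp t p‖ ≤ ‖F - hgm.toLp‖ + ‖hgm.toLp - polyLp t p‖ :=
        norm_sub_le_norm_sub_add_norm_sub _ _ _
    _ < ε := by linarith

/-! ### The Legendre operators in `L²` -/

lemma neg_one_pow_mul_eval_facePoly_pow (t : ℝ) (i : Fin d) (r : ℕ) (y : Fin d → ℝ) :
    (-1 : ℝ) ^ r * eval y (facePoly t i ^ r) = (1 - (y i - t) ^ 2) ^ r := by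
  rw [map_pow, eval_facePoly, ← mul_pow]
  ring

/-- Moving a Legendre operator over to a function with weak derivatives up to order `r`. -/
lemma integral_mul_legendreOp {t : ℝ} {i : Fin d} (r : ℕ) (G : ℕ → (Fin d → ℝ) → ℝ)
    (hG : ∀ n ≤ r, IntegrableOn (G n) (openCube d t))
    (hw : ∀ n < r, HasWeakPartial (openCube d t) i (G n) (G (n + 1)))
    (w : MvPolynomial (Fin d) ℝ) :
    ∫ y in openCube d t, G 0 y * eval y (legendreOp r t i w) =
      ∫ y in openCube d t, G r y * ((1 - (y i - t) ^ 2) ^ r * eval y ((pderiv i)^[r] w)) := by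
  rw [legendreOp_apply, integral_mul_iterate_pderiv r G hG hw (Dvd.intro _ rfl),
    ← integral_const_mul]
  refine integral_congr_ae (Eventually.of_forall fun y => ?_)
  simp only [map_mul, ← neg_one_pow_mul_eval_facePoly_pow]
  ring

lemma inner_polyLp (t : ℝ) (p q : MvPolynomial (Fin d) ℝ) :
    inner ℝ (polyLp t p) (polyLp t q) = ∫ y in openCube d t, eval y p * eval y q :=
  inner_toLp_real (memLp_eval_poly t p) (memLp_eval_poly t q)

lemma integrableOn_eval_poly (t : ℝ) (p : MvPolynomial (Fin d) ℝ) :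
    IntegrableOn (fun y => eval y p) (openCube d t) :=
  (memLp_eval_poly t p).integrable (by norm_num)

lemma inner_polyLp_legendreOp (r : ℕ) (t : ℝ) (i : Fin d) (p q : MvPolynomial (Fin d) ℝ) :
    inner ℝ (polyLp t p) (polyLp t (legendreOp r t i q)) = ∫ y in openCube d t,
      eval y ((pderiv i)^[r] p) * ((1 - (y i - t) ^ 2) ^ r * eval y ((pderiv i)^[r] q)) := by
  rw [inner_polyLp]
  refine integral_mul_legendreOp r (fun n y => eval y ((pderiv i)^[n] p))
    (fun n _ => integrableOn_eval_poly t _) (fun n _ => ?_) q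
  simp only [Function.iterate_succ_apply']
  exact hasWeakPartial_eval i _

lemma legendreOp_symmetric (r : ℕ) (t : ℝ) (i : Fin d) (p q : MvPolynomial (Fin d) ℝ) :
    inner ℝ (polyLp t (legendreOp r t i p)) (polyLp t q) =
      inner ℝ (polyLp t p) (polyLp t (legendreOp r t i q)) := by
  rw [real_inner_comm, inner_polyLp_legendreOp, inner_polyLp_legendreOp]
  refine integral_congr_ae (Eventually.of_forall fun y => ?_)
  simp only
  ring

lemma legendreSum_symmetric (r : ℕ) (t : ℝ) (p q : MvPolynomial (Fin d) ℝ) :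
    inner ℝ (polyLp t (legendreSum r t p)) (polyLp t q) =
      inner ℝ (polyLp t p) (polyLp t (legendreSum r t q)) := by
  simp only [legendreSum, LinearMap.sum_apply, map_sum, sum_inner, inner_sum, legendreOp_symmetric]

/-- The polynomial `(1 - (Xᵢ - t)²)^r ∂ᵢ^r p`. -/
noncomputable def weightedDeriv (r : ℕ) (t : ℝ) (i : Fin d) (p : MvPolynomial (Fin d) ℝ) :
    MvPolynomial (Fin d) ℝ := (-1) ^ r * facePoly t i ^ r * (pderiv i)^[r] p

lemma eval_weightedDeriv (r : ℕ) (t : ℝ) (i : Fin d) (p : MvPolynomial (Fin d) ℝ)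
    (y : Fin d → ℝ) : eval y (weightedDeriv r t i p) =
      (1 - (y i - t) ^ 2) ^ r * eval y ((pderiv i)^[r] p) := by
  rw [weightedDeriv, map_mul, map_mul, ← neg_one_pow_mul_eval_facePoly_pow]
  simp

/-- As the weight `(1 - (yᵢ - t)²)^r` is at most `1`, it bounds its square. -/
lemma norm_weightedDeriv_sq_le (r : ℕ) (t : ℝ) (i : Fin d) (p : MvPolynomial (Fin d) ℝ) :
    ‖polyLp t (weightedDeriv r t i p)‖ ^ 2 ≤
      inner ℝ (polyLp t p) (polyLp t (legendreOp r t i p)) := by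
  rw [inner_polyLp_legendreOp, ← real_inner_self_eq_norm_sq, inner_polyLp]
  simp only [← eval_weightedDeriv, ← map_mul]
  refine setIntegral_mono_on (integrableOn_eval_poly t _) (integrableOn_eval_poly t _)
    (measurableSet_openCube t) fun y hy => ?_
  simp only [map_mul, eval_weightedDeriv]
  have h0 := mem_openCube.1 hy i
  have h1 : (1 - (y i - t) ^ 2) ^ r ≤ 1 := pow_le_one₀ h0.le (by nlinarith [sq_nonneg (y i - t)])
  have h2 : 0 ≤ (1 - (y i - t) ^ 2) ^ r := pow_nonneg h0.le r
  nlinarith [mul_nonneg (mul_nonneg h2 (sub_nonneg.2 h1)) (sq_nonneg (eval y ((pderiv i)^[r] p)))]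

/-! ### The rate of polynomial approximation on a cube -/

/-- The subspace of `L²` of the cube formed by the polynomials of degree at most `k`. -/
noncomputable def polyDegLE (d k : ℕ) (t : ℝ) :
    Submodule ℝ (Lp ℝ 2 (volume.restrict (openCube d t))) :=
  (MvPolynomial.restrictTotalDegree (Fin d) ℝ k).map (polyLp t)

instance (k : ℕ) (t : ℝ) : FiniteDimensional ℝ (polyDegLE d k t) := by
  unfold polyDegLE; infer_instance

lemma norm_sub_starProjection_le {H : Type*} [NormedAddCommGroup H] [InnerProductSpace ℝ H]
    (U : Submodule ℝ H) [U.HasOrthogonalProjection] (x : H) {y : H} (hy : y ∈ U) :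
    ‖x - U.starProjection x‖ ≤ ‖x - y‖ := by
  rw [Submodule.starProjection_minimal]
  exact ciInf_le ⟨0, by rintro _ ⟨z, rfl⟩; exact norm_nonneg _⟩ (⟨y, hy⟩ : U)

lemma polyDegLE_mono {k K : ℕ} (hK : k ≤ K) (t : ℝ) : polyDegLE d k t ≤ polyDegLE d K t := by
  refine Submodule.map_mono fun p hp => ?_
  rw [MvPolynomial.mem_restrictTotalDegree] at hp ⊢
  exact hp.trans hK

lemma polyLp_mem {k : ℕ} (t : ℝ) {p : MvPolynomial (Fin d) ℝ} (hp : p.totalDegree ≤ k) :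
    polyLp t p ∈ polyDegLE d k t :=
  Submodule.mem_map_of_mem ((MvPolynomial.mem_restrictTotalDegree _ _ _).2 hp)

lemma exists_of_mem_polyDegLE {k : ℕ} {t : ℝ} {u : Lp ℝ 2 (volume.restrict (openCube d t))}
    (hu : u ∈ polyDegLE d k t) :
    ∃ p : MvPolynomial (Fin d) ℝ, p.totalDegree ≤ k ∧ polyLp t p = u := by
  obtain ⟨p, hp, hpu⟩ := hu
  exact ⟨p, (MvPolynomial.mem_restrictTotalDegree _ _ _).1 hp, hpu⟩

/-- On the polynomials orthogonal to those of degree at most `k`, the sum of the Legendre operators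
is invertible, and its inverse is of order `k ^ (-2 r)`. -/
lemma exists_legendreSum_eq {r k : ℕ} (hr : 1 ≤ r) (hd : 0 < d) (hk : d * r ≤ k) (t : ℝ)
    {p : MvPolynomial (Fin d) ℝ} (hp : polyLp t p ∈ (polyDegLE d k t)ᗮ) :
    ∃ w, legendreSum r t w = p ∧
      inner ℝ (polyLp t p) (polyLp t w) ≤ ((d * r / k : ℝ) ^ r) ^ 2 * ‖polyLp t p‖ ^ 2 := by
  set K := p.totalDegree with hK
  obtain ⟨M, hM, hfin⟩ : ∃ M : Submodule ℝ (MvPolynomial (Fin d) ℝ),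
      (∀ q, q ∈ M ↔ q.totalDegree ≤ K ∧ polyLp t q ∈ (polyDegLE d k t)ᗮ) ∧
        FiniteDimensional ℝ M := by
    refine ⟨MvPolynomial.restrictTotalDegree (Fin d) ℝ K ⊓ ((polyDegLE d k t)ᗮ).comap (polyLp t),
      fun q => ?_, Submodule.finiteDimensional_inf_left _ _⟩
    rw [Submodule.mem_inf, MvPolynomial.mem_restrictTotalDegree, Submodule.mem_comap]
  have hEM (p) (hp : p ∈ M) : legendreSum r t p ∈ M := by
    rw [hM] at hp ⊢
    refine ⟨(totalDegree_legendreSum_le hr t p).trans hp.1, fun v hv => ?_⟩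
    obtain ⟨q, hq, rfl⟩ := exists_of_mem_polyDegLE hv
    rw [← legendreSum_symmetric]
    exact hp.2 _ (polyLp_mem t ((totalDegree_legendreSum_le hr t q).trans hq))
  have hk0 : (0 : ℝ) < k := by
    have : 0 < d * r := Nat.mul_pos hd hr
    exact_mod_cast this.trans_le hk
  have hd0 : (0 : ℝ) < d := by exact_mod_cast hd
  have hr0 : (0 : ℝ) < r := by exact_mod_cast hr
  set c : ℝ := ((k : ℝ) / (d * r)) ^ (2 * r) with hc
  have hc0 : 0 < c := by positivity
  have hcs : c⁻¹ = ((d * r / k : ℝ) ^ r) ^ 2 := by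
    rw [hc, ← inv_pow, inv_div, mul_comm 2 r, pow_mul]
  have heig (μ : ℝ) (q : M) (hq0 : q ≠ 0) (hEq : (legendreSum r t).restrict hEM q = μ • q) :
      c ≤ μ := by
    obtain ⟨q, hq⟩ := q
    refine le_eigenvalue_legendreSum hr hd hk t (p := q) ?_ (congrArg Subtype.val hEq)
    by_contra! hcon
    have h1 : inner ℝ (polyLp t q) (polyLp t q) = 0 := ((hM q).1 hq).2 _ (polyLp_mem t hcon)
    rw [inner_self_eq_zero] at h1
    exact hq0 (Subtype.ext (polyLp_injective t (h1.trans (map_zero _).symm)))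
  have hinj : Function.Injective (polyLp t ∘ₗ M.subtype) :=
    fun a b h => Subtype.ext (polyLp_injective t h)
  have hsym (a b : M) :
      inner ℝ ((polyLp t ∘ₗ M.subtype) ((legendreSum r t).restrict hEM a))
        ((polyLp t ∘ₗ M.subtype) b) =
      inner ℝ ((polyLp t ∘ₗ M.subtype) a)
        ((polyLp t ∘ₗ M.subtype) ((legendreSum r t).restrict hEM b)) := by
    simp only [LinearMap.comp_apply, Submodule.subtype_apply, LinearMap.coe_restrict_apply]
    exact legendreSum_symmetric r t a.1 b.1
  obtain ⟨w, hEw, hpw⟩ := exists_preimage_of_le_eigenvalues (polyLp t ∘ₗ M.subtype) hinj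
    ((legendreSum r t).restrict hEM) hsym hc0 heig ⟨p, (hM p).2 ⟨le_rfl, hp⟩⟩
  simp only [LinearMap.comp_apply, Submodule.subtype_apply] at hpw
  rw [hcs] at hpw
  exact ⟨w, congrArg Subtype.val hEw, hpw⟩

/-- A function with weak derivatives up to order `r` pairs with a value of the Legendre operator
like its derivative of order `r` pairs with the energy of that operator. -/
lemma inner_legendreOp_le {r : ℕ} {t : ℝ} {N S : ℝ} (hN : 0 ≤ N) (hS : 0 ≤ S) (i : Fin d)
    (G : ℕ → (Fin d → ℝ) → ℝ)
    (hG : ∀ n ≤ r, MemLp (G n) 2 (volume.restrict (openCube d t)))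
    (hw : ∀ n < r, HasWeakPartial (openCube d t) i (G n) (G (n + 1)))
    (hGN : ∫ y in openCube d t, G r y ^ 2 ≤ N ^ 2) {w : MvPolynomial (Fin d) ℝ}
    (hwS : inner ℝ (polyLp t w) (polyLp t (legendreOp r t i w)) ≤ S ^ 2) :
    inner ℝ (hG 0 (Nat.zero_le r)).toLp (polyLp t (legendreOp r t i w)) ≤ N * S := by
  have h1 : inner ℝ (hG 0 (Nat.zero_le r)).toLp (polyLp t (legendreOp r t i w)) =
      inner ℝ (hG r le_rfl).toLp (polyLp t (weightedDeriv r t i w)) := by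
    have h2 := integral_mul_legendreOp r G (fun n hn => (hG n hn).integrable (by norm_num)) hw w
    refine (inner_toLp_real (hG 0 (Nat.zero_le r)) (memLp_eval_poly t _)).trans (h2.trans ?_)
    simp only [← eval_weightedDeriv]
    exact (inner_toLp_real (hG r le_rfl) (memLp_eval_poly t _)).symm
  rw [h1]
  refine (real_inner_le_norm _ _).trans (mul_le_mul ?_ ?_ (norm_nonneg _) hN)
  · refine (abs_le_of_sq_le_sq' ?_ hN).2
    rw [norm_toLp_sq_real]
    exact hGN
  · exact (abs_le_of_sq_le_sq' ((norm_weightedDeriv_sq_le r t i w).trans hwS) hS).2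

/-- The part of `f` of polynomial degree between `k` and `K` is of order `k ^ (-r)`. -/
lemma norm_starProjection_sub_le {r k K : ℕ} (hr : 1 ≤ r) (hd : 0 < d) (hk : d * r ≤ k)
    (hK : k ≤ K) (t : ℝ) {N : ℝ} (hN : 0 ≤ N) (f : (Fin d → ℝ) → ℝ)
    (hf : MemLp f 2 (volume.restrict (openCube d t))) (G : Fin d → ℕ → (Fin d → ℝ) → ℝ)
    (hG0 : ∀ i, G i 0 = f)
    (hG : ∀ i, ∀ n ≤ r, MemLp (G i n) 2 (volume.restrict (openCube d t)))
    (hw : ∀ i, ∀ n < r, HasWeakPartial (openCube d t) i (G i n) (G i (n + 1)))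
    (hGN : ∀ i, ∫ y in openCube d t, G i r y ^ 2 ≤ N ^ 2) :
    ‖(polyDegLE d K t).starProjection hf.toLp - (polyDegLE d k t).starProjection hf.toLp‖ ≤
      N * (d * (d * r / k : ℝ) ^ r) := by
  set F := hf.toLp with hF
  set u := (polyDegLE d K t).starProjection F - (polyDegLE d k t).starProjection F with hu
  have huK : u ∈ polyDegLE d K t :=
    sub_mem (Submodule.starProjection_apply_mem _ _)
      (polyDegLE_mono hK t (Submodule.starProjection_apply_mem _ _))
  have huk : u ∈ (polyDegLE d k t)ᗮ := by
    have h : u = (F - (polyDegLE d k t).starProjection F) -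
        (F - (polyDegLE d K t).starProjection F) := by rw [hu]; abel
    rw [h]
    exact sub_mem (Submodule.sub_starProjection_mem_orthogonal _)
      (Submodule.orthogonal_le (polyDegLE_mono hK t)
        (Submodule.sub_starProjection_mem_orthogonal _))
  have hFu : inner ℝ F u = ‖u‖ * ‖u‖ := by
    have h1 := Submodule.starProjection_inner_eq_zero (K := polyDegLE d K t) F u huK
    have h2 : inner ℝ ((polyDegLE d k t).starProjection F) u = 0 :=
      huk _ (Submodule.starProjection_apply_mem _ _)
    rw [← real_inner_self_eq_norm_mul_norm]
    conv_rhs => rw [hu]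
    rw [inner_sub_left] at h1 ⊢
    linarith
  obtain ⟨p, -, hpu⟩ := exists_of_mem_polyDegLE huK
  set s : ℝ := (d * r / k : ℝ) ^ r with hs
  have hs0 : 0 ≤ s := by positivity
  obtain ⟨w, hEw, hpw⟩ := exists_legendreSum_eq hr hd hk t (hpu.symm ▸ huk)
  rw [hpu] at hpw
  -- the energies of the single operators are bounded by their sum
  have henergy (i : Fin d) : inner ℝ (polyLp t w) (polyLp t (legendreOp r t i w)) ≤
      (s * ‖u‖) ^ 2 := by
    have h1 : inner ℝ u (polyLp t w) =
        ∑ j, inner ℝ (polyLp t w) (polyLp t (legendreOp r t j w)) := by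
      rw [← hpu, ← hEw, legendreSum_symmetric, legendreSum, LinearMap.sum_apply, map_sum, inner_sum]
    have h2 := Finset.single_le_sum
      (f := fun j => inner ℝ (polyLp t w) (polyLp t (legendreOp r t j w)))
      (fun j _ => (sq_nonneg _).trans (norm_weightedDeriv_sq_le r t j w)) (Finset.mem_univ i)
    rw [mul_pow]
    exact h2.trans (h1 ▸ hpw)
  have hterm (i : Fin d) : inner ℝ F (polyLp t (legendreOp r t i w)) ≤ N * (s * ‖u‖) := by
    have h := inner_legendreOp_le hN (by positivity) i (G i) (hG i) (hw i) (hGN i) (henergy i)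
    rwa [MemLp.toLp_congr (hG i 0 (Nat.zero_le r)) hf (by rw [hG0])] at h
  have hmain : ‖u‖ * ‖u‖ ≤ N * (d * s) * ‖u‖ := by
    calc ‖u‖ * ‖u‖ = ∑ i, inner ℝ F (polyLp t (legendreOp r t i w)) := by
          rw [← hFu, ← hpu, ← hEw, legendreSum, LinearMap.sum_apply, map_sum, inner_sum]
      _ ≤ ∑ _i : Fin d, N * (s * ‖u‖) := Finset.sum_le_sum fun i _ => hterm i
      _ = N * (d * s) * ‖u‖ := by
          rw [Finset.sum_const, Finset.card_univ, Fintype.card_fin, nsmul_eq_mul]; ring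
  rcases (norm_nonneg u).eq_or_lt with h | h
  · rw [← h]; positivity
  · exact le_of_mul_le_mul_right hmain h

/-- The rate of polynomial approximation in `L²` of a cube of a function with weak derivatives up to
order `r` in all coordinate directions. -/
lemma exists_poly_integral_sub_sq_le {r k : ℕ} (hr : 1 ≤ r) (hd : 0 < d) (hk : r ≤ k)
    (t : ℝ) {N : ℝ} (hN : 0 ≤ N) (f : (Fin d → ℝ) → ℝ)
    (hf : MemLp f 2 (volume.restrict (openCube d t))) (hfN : ∫ y in openCube d t, f y ^ 2 ≤ N ^ 2)
    (G : Fin d → ℕ → (Fin d → ℝ) → ℝ) (hG0 : ∀ i, G i 0 = f)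
    (hG : ∀ i, ∀ n ≤ r, MemLp (G i n) 2 (volume.restrict (openCube d t)))
    (hw : ∀ i, ∀ n < r, HasWeakPartial (openCube d t) i (G i n) (G i (n + 1)))
    (hGN : ∀ i, ∫ y in openCube d t, G i r y ^ 2 ≤ N ^ 2) :
    ∃ p : MvPolynomial (Fin d) ℝ, p.totalDegree ≤ k ∧
      ∫ y in openCube d t, (f y - eval y p) ^ 2 ≤ (N * (d * (d * r / k : ℝ) ^ r)) ^ 2 := by
  have hk0 : (0 : ℝ) < k := by exact_mod_cast (hr.trans hk)
  rcases lt_or_ge k (d * r) with hlt | hge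
  -- in low degrees the zero polynomial will do
  · refine ⟨0, by simp, ?_⟩
    have h1 : 1 ≤ (d * r / k : ℝ) ^ r := by
      refine one_le_pow₀ ((one_le_div hk0).2 ?_)
      exact_mod_cast hlt.le
    have h2 : (1 : ℝ) ≤ d := by exact_mod_cast hd
    have h3 : N ≤ N * (d * (d * r / k : ℝ) ^ r) :=
      le_mul_of_one_le_right hN (one_le_mul_of_one_le_of_one_le h2 h1)
    simp only [map_zero, sub_zero]
    exact hfN.trans (pow_le_pow_left₀ hN h3 2)
  · obtain ⟨p, hp, hpF⟩ := exists_of_mem_polyDegLE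
      (Submodule.starProjection_apply_mem (polyDegLE d k t) hf.toLp)
    refine ⟨p, hp, ?_⟩
    have h1 : ∫ y in openCube d t, (f y - eval y p) ^ 2 = ‖hf.toLp - polyLp t p‖ ^ 2 := by
      have h2 := norm_toLp_sq_real (hf.sub (memLp_eval_poly t p))
      rw [MemLp.toLp_sub hf (memLp_eval_poly t p)] at h2
      exact h2.symm
    rw [h1, hpF]
    refine pow_le_pow_left₀ (norm_nonneg _) (le_of_forall_pos_le_add fun ε hε => ?_) 2
    obtain ⟨q, hq⟩ := exists_norm_sub_polyLp_lt t hf.toLp hε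
    set K := max k q.totalDegree
    have h3 := norm_sub_starProjection_le (polyDegLE d K t) hf.toLp 
      (polyLp_mem t (le_max_right k q.totalDegree))
    have h4 := norm_starProjection_sub_le hr hd hge (le_max_left k q.totalDegree) t hN f hf G hG0 hG
      hw hGN
    have h5 := norm_sub_le_norm_sub_add_norm_sub hf.toLp
      ((polyDegLE d K t).starProjection hf.toLp) ((polyDegLE d k t).starProjection hf.toLp)
    linarith

/-! ### Weak derivatives of Sobolev functions -/

lemma single_mem_multiIndices (i : Fin d) {n r : ℕ} (hn : n ≤ r) :
    Pi.single i n ∈ multiIndices d r := by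
  refine Finset.mem_filter.2 ⟨Fintype.mem_piFinset.2 fun j => ?_, ?_⟩
  · rw [Finset.mem_range, Nat.lt_succ_iff]
    by_cases h : j = i
    · subst h; simpa using hn
    · simp [h]
  · rw [Finset.sum_pi_single']
    simpa using hn

section Sobolev
variable {Ω : Set (Fin d → ℝ)} {r : ℕ} {f : (Fin d → ℝ) → ℝ} {α : Fin d → ℕ}

lemma HasL2WeakDeriv.memLp (h : HasL2WeakDeriv Ω α f) :
    MemLp (weakDeriv Ω α f) 2 (volume.restrict Ω) := by
  rw [weakDeriv, dif_pos h]; exact h.choose_spec.1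

lemma HasL2WeakDeriv.isWeakDeriv (h : HasL2WeakDeriv Ω α f) :
    IsWeakDeriv Ω α f (weakDeriv Ω α f) := by
  rw [weakDeriv, dif_pos h]; exact h.choose_spec.2

lemma integral_weakDeriv_sq_le (hα : α ∈ multiIndices d r) :
    ∫ y in Ω, weakDeriv Ω α f y ^ 2 ≤ sobolevNorm Ω r f ^ 2 := by
  rw [sobolevNorm, Real.sq_sqrt (Finset.sum_nonneg fun _ _ => integral_nonneg fun _ => sq_nonneg _)]
  exact Finset.single_le_sum (f := fun α => ∫ y in Ω, weakDeriv Ω α f y ^ 2)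
    (fun _ _ => integral_nonneg fun _ => sq_nonneg _) hα

/-- The weak derivative of order zero of `f` is `f`. -/
lemma weakDeriv_zero_ae_eq {t : ℝ} (hf : MemLp f 2 (volume.restrict (openCube d t))) :
    weakDeriv (openCube d t) 0 f =ᵐ[volume.restrict (openCube d t)] f := by
  have h : HasL2WeakDeriv (openCube d t) 0 f := ⟨f, hf, isWeakDeriv_zero _ f⟩
  have hi : IntegrableOn (fun y => weakDeriv (openCube d t) 0 f y - f y) (openCube d t) :=
    (h.memLp.sub hf).integrable (by norm_num)
  have h1 := (isOpen_openCube t).ae_eq_zero_of_integral_contDiff_smul_eq_zero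
    (μ := volume) (f := fun y => weakDeriv (openCube d t) 0 f y - f y) hi.locallyIntegrableOn (by
      intro φ hφ hc hs
      have e1 := h.isWeakDeriv φ hφ hc hs
      have e2 := isWeakDeriv_zero (openCube d t) f φ hφ hc hs
      rw [e1] at e2
      simp only [Pi.zero_apply, Finset.sum_const_zero, pow_zero, one_mul] at e2
      rw [← setIntegral_eq_integral_of_forall_compl_eq_zero (s := openCube d t) fun x hx => by
        rw [image_eq_zero_of_notMem_tsupport fun h => hx (hs h), zero_smul]]
      have hφ2 : MemLp φ 2 (volume.restrict (openCube d t)) :=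
        (hφ.continuous.memLp_of_hasCompactSupport hc).restrict _
      have i1 : Integrable (fun y => weakDeriv (openCube d t) 0 f y * φ y)
        (volume.restrict (openCube d t)) := h.memLp.integrable_mul hφ2
      have i2 : Integrable (fun y => f y * φ y)
        (volume.restrict (openCube d t)) := hf.integrable_mul hφ2
      calc _ = ∫ y in openCube d t, (weakDeriv (openCube d t) 0 f y * φ y - f y * φ y) := by
            refine integral_congr_ae (Eventually.of_forall fun y => ?_)
            simp only [smul_eq_mul]; ring
        _ = 0 := by rw [integral_sub i1 i2, e2, sub_self])
  rw [EventuallyEq, ae_restrict_iff' (measurableSet_openCube t)]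
  filter_upwards [h1] with y hy hyt using sub_eq_zero.1 (hy hyt)

/-- Functions in the Sobolev space `W^{r,2}` of a cube are approximated in `L²` by polynomials of
degree `k` at the rate `k ^ (-r)`. -/
lemma MemSobolev.exists_poly {k : ℕ} (hr : 1 ≤ r) (hd : 0 < d) (hk : r ≤ k) {t C : ℝ}
    (hC : 0 ≤ C) (hf : MemSobolev (openCube d t) r f) (hfC : sobolevNorm (openCube d t) r f ≤ C) :
    ∃ p : MvPolynomial (Fin d) ℝ, p.totalDegree ≤ k ∧
      ∫ y in openCube d t, (f y - eval y p) ^ 2 ≤ (C * (d * (d * r / k : ℝ) ^ r)) ^ 2 := by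
  have hle {α} (hα : α ∈ multiIndices d r) :
      ∫ y in openCube d t, weakDeriv (openCube d t) α f y ^ 2 ≤ C ^ 2 :=
    (integral_weakDeriv_sq_le hα).trans (pow_le_pow_left₀ (Real.sqrt_nonneg _) hfC 2)
  have hsingle (i : Fin d) {n : ℕ} (hn : n ≤ r) :=
    hf.2 _ (single_mem_multiIndices i hn)
  let G (i : Fin d) (n : ℕ) : (Fin d → ℝ) → ℝ :=
    if n = 0 then f else weakDeriv (openCube d t) (Pi.single i n) f
  have hGw (i : Fin d) (n : ℕ) (hn : n ≤ r) :
      IsWeakDeriv (openCube d t) (Pi.single i n) f (G i n) := by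
    by_cases h : n = 0
    · subst h
      simpa [G] using isWeakDeriv_zero (openCube d t) f
    · simpa only [G, if_neg h] using (hsingle i hn).isWeakDeriv
  refine exists_poly_integral_sub_sq_le hr hd hk t hC f hf.1 ?_ G (fun i => if_pos rfl)
    (fun i n hn => ?_) (fun i n hn => (hGw i n hn.le).hasWeakPartial (hGw i (n + 1) hn)) fun i => ?_
  · refine le_of_eq_of_le (integral_congr_ae ?_)
      (hle (α := 0) (by simpa using single_mem_multiIndices (⟨0, hd⟩ : Fin d) (Nat.zero_le r)))
    filter_upwards [weakDeriv_zero_ae_eq hf.1] with y hy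
    rw [hy]
  · by_cases h : n = 0
    · simpa only [G, if_pos h] using hf.1
    · simpa only [G, if_neg h] using (hsingle i hn).memLp
  · simpa only [G, if_neg (show r ≠ 0 by omega)] using hle (single_mem_multiIndices i le_rfl)

end Sobolev

variable {m l : ℕ}

/-! ### Functional and discrete parts -/

instance : IsFiniteMeasure (nu d m l) := by
  have h : IsFiniteMeasure (volume.restrict (cubes d m)) := by
    refine isFiniteMeasure_restrict.2 (IsCompact.measure_lt_top ?_).ne
    exact isCompact_iUnion fun i => isCompact_cube _
  unfold nu
  infer_instance

lemma integral_nu {g : (Fin d → ℝ) ⊕ Fin l → ℝ} (hg : Integrable g (nu d m l)) :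
    ∫ s, g s ∂nu d m l = (∫ y in cubes d m, g (Sum.inl y)) + ∑ i, g (Sum.inr i) := by
  have h1 := hg.mono_measure (map_inl_le_nu (d := d) (m := m) (l := l))
  have h2 : Integrable g (Measure.count.map (Sum.inr : Fin l → (Fin d → ℝ) ⊕ Fin l)) :=
    hg.mono_measure (Measure.le_add_left le_rfl)
  rw [nu, integral_add_measure h1 h2, embedding_inl.integral_map, embedding_inr.integral_map,
    integral_count]

lemma coeFn_funPart (x : X d m l) :
    funPart x =ᵐ[nu d m l] (Set.range Sum.inl).indicator x := MemLp.coeFn_toLp _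

/-- The element of `X` with discrete part `v` which vanishes on the cubes. -/
noncomputable def ofDisc (d m : ℕ) (v : Fin l → ℝ) : X d m l :=
  MemLp.toLp (Sum.elim (fun _ => 0) v) (MemLp.of_bound
    (Measurable.sumElim measurable_const (measurable_of_finite v)).aestronglyMeasurable
    (∑ i, |v i|) (Eventually.of_forall fun s => by
      rcases s with y | i
      · simpa using Finset.sum_nonneg fun i _ => abs_nonneg (v i)
      · exact Finset.single_le_sum (f := fun i => |v i|) (fun i _ => abs_nonneg _)
          (Finset.mem_univ i)))

lemma coeFn_ofDisc (v : Fin l → ℝ) :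
    ofDisc d m v =ᵐ[nu d m l] Sum.elim (fun _ => 0) v := MemLp.coeFn_toLp _

lemma discPart_sub (x y : X d m l) : discPart (x - y) = discPart x - discPart y :=
  funext fun i => discPart_eq_of_ae (Lp.coeFn_sub x y) i

@[simp]
lemma discPart_zero : discPart (0 : X d m l) = 0 :=
  funext fun i => discPart_eq_of_ae (Lp.coeFn_zero ℝ 2 (nu d m l)) i

@[simp]
lemma discPart_funPart (x : X d m l) : discPart (funPart x) = 0 :=
  funext fun i => (discPart_eq_of_ae (coeFn_funPart x) i).trans (by simp)

@[simp]
lemma discPart_ofDisc (v : Fin l → ℝ) : discPart (ofDisc d m v) = v :=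
  funext fun i => discPart_eq_of_ae (coeFn_ofDisc v) i

lemma funPart_add_ofDisc (x : X d m l) : funPart x + ofDisc d m (discPart x) = x := by
  refine Lp.ext ?_
  filter_upwards [Lp.coeFn_add (funPart x) (ofDisc d m (discPart x)), coeFn_funPart x,
    coeFn_ofDisc (d := d) (m := m) (discPart x)] with s h1 h2 h3
  rw [h1, Pi.add_apply, h2, h3]
  rcases s with y | i
  · simp
  · simp [discPart]

lemma funPart_add (x y : X d m l) : funPart (x + y) = funPart x + funPart y := by
  refine Lp.ext ?_
  filter_upwards [coeFn_funPart (x + y), coeFn_funPart x, coeFn_funPart y, Lp.coeFn_add x y,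
    Lp.coeFn_add (funPart x) (funPart y)] with s h1 h2 h3 h4 h5
  rw [h1, h5, Pi.add_apply, h2, h3]
  by_cases hs : s ∈ Set.range (Sum.inl : (Fin d → ℝ) → (Fin d → ℝ) ⊕ Fin l)
  · simp only [Set.indicator_of_mem hs, h4, Pi.add_apply]
  · simp only [Set.indicator_of_notMem hs, add_zero]

lemma funPart_eq_sub (x : X d m l) : funPart x = x - ofDisc d m (discPart x) :=
  eq_sub_of_add_eq (funPart_add_ofDisc x)

lemma funPart_sub (x y : X d m l) : funPart (x - y) = funPart x - funPart y := by
  rw [eq_sub_iff_add_eq, ← funPart_add, sub_add_cancel]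

lemma funPart_of_discPart_eq_zero {x : X d m l} (h : discPart x = 0) : funPart x = x := by
  have h0 : ofDisc d m (0 : Fin l → ℝ) = 0 := by
    refine Lp.ext ?_
    filter_upwards [coeFn_ofDisc (d := d) (m := m) (0 : Fin l → ℝ),
      Lp.coeFn_zero ℝ 2 (nu d m l)] with s h1 h2
    rw [h1, h2]
    rcases s with y | i <;> rfl
  rw [funPart_eq_sub, h, h0, sub_zero]

@[simp]
lemma funPart_zero : funPart (0 : X d m l) = 0 := funPart_of_discPart_eq_zero discPart_zero

@[simp]
lemma funPart_ofDisc (v : Fin l → ℝ) : funPart (ofDisc d m v) = 0 := by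
  rw [funPart_eq_sub, discPart_ofDisc, sub_self]

lemma integrable_mul_X (x y : X d m l) : Integrable (fun s => x s * y s) (nu d m l) :=
  (Lp.memLp x).integrable_mul (Lp.memLp y)

lemma inner_X (x y : X d m l) : inner ℝ x y =
    (∫ s in cubes d m, x (Sum.inl s) * y (Sum.inl s)) + ∑ i, discPart x i * discPart y i := by
  have h := inner_toLp_real (Lp.memLp x) (Lp.memLp y)
  rw [Lp.toLp_coeFn, Lp.toLp_coeFn, integral_nu (integrable_mul_X x y)] at h
  exact h

lemma funPart_inl_ae (x : X d m l) :
    ∀ᵐ y ∂volume.restrict (cubes d m), funPart x (Sum.inl y) = x (Sum.inl y) := by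
  have h1 := (Measure.absolutelyContinuous_of_le map_inl_le_nu).ae_le (coeFn_funPart x)
  filter_upwards [ae_of_ae_map measurable_inl.aemeasurable h1] with y hy
  rw [hy, Set.indicator_of_mem (Set.mem_range_self y)]

lemma inner_eq_funPart_add_discPart (x y : X d m l) : inner ℝ x y =
    inner ℝ (funPart x) (funPart y) + ∑ i, discPart x i * discPart y i := by
  rw [inner_X x y, inner_X (funPart x)]
  simp only [discPart_funPart, Pi.zero_apply, mul_zero, Finset.sum_const_zero, add_zero]
  congr 1
  refine integral_congr_ae ?_
  filter_upwards [funPart_inl_ae x, funPart_inl_ae y] with s h1 h2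
  rw [h1, h2]

lemma inner_ofDisc (x : X d m l) (v : Fin l → ℝ) :
    inner ℝ x (ofDisc d m v) = ∑ i, discPart x i * v i := by
  rw [inner_eq_funPart_add_discPart]
  simp

lemma inner_ofDisc_single (x : X d m l) (i : Fin l) (a : ℝ) :
    inner ℝ x (ofDisc d m (Pi.single i a)) = discPart x i * a := by
  rw [inner_ofDisc, Finset.sum_eq_single i (fun j _ hj => by simp [hj]) (by simp)]
  simp

lemma norm_funPart_sq_le (x : X d m l) : ‖funPart x‖ ^ 2 ≤ ‖x‖ ^ 2 := by
  rw [← real_inner_self_eq_norm_sq, ← real_inner_self_eq_norm_sq, inner_eq_funPart_add_discPart x x]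
  exact le_add_of_nonneg_right (Finset.sum_nonneg fun i _ => mul_self_nonneg _)

lemma norm_funPart_le (x : X d m l) : ‖funPart x‖ ≤ ‖x‖ :=
  (abs_le_of_sq_le_sq' (norm_funPart_sq_le x) (norm_nonneg x)).2

lemma continuous_discPart : Continuous (discPart : X d m l → Fin l → ℝ) := by
  refine continuous_pi fun i => ?_
  have h : (fun x : X d m l => discPart x i) =
      fun x => inner ℝ x (ofDisc d m (Pi.single i 1)) := by
    funext x; rw [inner_ofDisc_single, mul_one]
  rw [h]
  fun_prop

/-! ### Hölder's inequality for the discrete parts -/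

lemma lzNorm_nonneg {z : ℝ≥0∞} (hz : 1 ≤ z) (v : Fin l → ℝ) : 0 ≤ lzNorm z v :=
  have : Fact (1 ≤ z) := ⟨hz⟩
  norm_nonneg _

lemma continuous_lzNorm {z : ℝ≥0∞} (hz : 1 ≤ z) : Continuous (lzNorm z : (Fin l → ℝ) → ℝ) := by
  have : Fact (1 ≤ z) := ⟨hz⟩
  exact continuous_norm.comp (PiLp.continuous_toLp z _)

lemma lzNorm_one (v : Fin l → ℝ) : lzNorm 1 v = ∑ i, |v i| := by
  rw [lzNorm, PiLp.norm_eq_of_L1]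
  rfl

lemma abs_le_lzNorm_top (v : Fin l → ℝ) (i : Fin l) : |v i| ≤ lzNorm ⊤ v :=
  PiLp.norm_apply_le (WithLp.toLp ⊤ v : PiLp ⊤ fun _ : Fin l => ℝ) i

lemma sum_mul_le_one_top (u v : Fin l → ℝ) : ∑ i, u i * v i ≤ lzNorm 1 u * lzNorm ⊤ v := by
  rw [lzNorm_one, Finset.sum_mul]
  refine Finset.sum_le_sum fun i _ => (le_abs_self _).trans ?_
  rw [abs_mul]
  exact mul_le_mul_of_nonneg_left (abs_le_lzNorm_top v i) (abs_nonneg _)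

/-- Hölder's inequality, including the exponents `1` and `∞`. -/
lemma sum_mul_le_lzNorm {z zs : ℝ≥0∞} (h : z.HolderConjugate zs) (u v : Fin l → ℝ) :
    ∑ i, u i * v i ≤ lzNorm z u * lzNorm zs v := by
  by_cases hz : z = ⊤
  · subst hz
    have h1 : zs = 1 := ENNReal.HolderConjugate.unique ⊤ zs 1
    subst h1
    rw [mul_comm]
    simpa only [mul_comm] using sum_mul_le_one_top v u
  by_cases hzs : zs = ⊤
  · subst hzs
    have := h.symm
    have h1 : z = 1 := ENNReal.HolderConjugate.unique ⊤ z 1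
    subst h1
    exact sum_mul_le_one_top u v
  have hconj : z.toReal.HolderConjugate zs.toReal :=
    ENNReal.HolderConjugate.toReal_of_ne_top hz hzs
  rw [lzNorm, lzNorm, PiLp.norm_eq_sum hconj.pos, PiLp.norm_eq_sum hconj.symm.pos]
  exact Real.inner_le_Lp_mul_Lq Finset.univ u v hconj

lemma abs_sum_mul_le_lzNorm {z zs : ℝ≥0∞} (h : z.HolderConjugate zs) (u v : Fin l → ℝ) :
    |∑ i, u i * v i| ≤ lzNorm z u * lzNorm zs v := by
  have : Fact (1 ≤ z) := ⟨ENNReal.HolderConjugate.one_le z zs⟩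
  have h1 := sum_mul_le_lzNorm h (-u) v
  have h2 : lzNorm z (-u) = lzNorm z u := by
    rw [lzNorm, WithLp.toLp_neg, norm_neg, lzNorm]
  simp only [Pi.neg_apply, neg_mul, Finset.sum_neg_distrib, h2] at h1
  exact abs_le.2 ⟨by linarith, sum_mul_le_lzNorm h u v⟩

/-- The pairing in `X` is bounded by the norms of the functional and of the discrete parts. -/
lemma abs_inner_le_of_mem_ball {z zs : ℝ≥0∞} (h : z.HolderConjugate zs) {γ : ℝ × ℝ} {x : X d m l}
    (hx : x ∈ ball z γ) (a : X d m l) :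
    |inner ℝ a x| ≤ γ.1 * ‖funPart a‖ + γ.2 * lzNorm zs (discPart a) := by
  rw [inner_eq_funPart_add_discPart]
  refine (abs_add_le _ _).trans (add_le_add ?_ ?_)
  · rw [mul_comm γ.1]
    exact (abs_real_inner_le_norm _ _).trans (mul_le_mul_of_nonneg_left hx.1 (norm_nonneg _))
  · have h1 := abs_sum_mul_le_lzNorm h (discPart x) (discPart a)
    have hs := h.symm
    simp only [mul_comm (discPart a _)]
    exact h1.trans (mul_le_mul_of_nonneg_right hx.2
      (lzNorm_nonneg (ENNReal.HolderConjugate.one_le zs z) _))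

/-! ### The projection onto piecewise polynomials -/

lemma ofDisc_mem_polySpace (J : Fin m → ℕ) (v : Fin l → ℝ) : ofDisc d m v ∈ polySpace d l J := by
  intro i
  refine ⟨0, by simp, ?_⟩
  filter_upwards [ae_cube_of_ae_nu (coeFn_ofDisc (d := d) (m := m) v) i] with y hy
  rw [hy]; simp

/-- The projection does not change the discrete part. -/
lemma discPart_proj (J : Fin m → ℕ) (x : X d m l) : discPart (proj l J x) = discPart x := by
  funext i
  have h : inner ℝ (x - proj l J x) (ofDisc d m (Pi.single i 1)) = 0 :=
    Submodule.starProjection_inner_eq_zero _ _ (ofDisc_mem_polySpace J _)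
  rw [inner_ofDisc_single, discPart_sub, mul_one, Pi.sub_apply, sub_eq_zero] at h
  exact h.symm

lemma proj_ofDisc (J : Fin m → ℕ) (v : Fin l → ℝ) : proj l J (ofDisc d m v) = ofDisc d m v :=
  Submodule.starProjection_eq_self_iff.2 (ofDisc_mem_polySpace J v)

/-- As `𝐏_J` contains everything that lives on the `l` points, the projection acts on the functional
part only. -/
lemma funPart_proj (J : Fin m → ℕ) (x : X d m l) : funPart (proj l J x) = proj l J (funPart x) := by
  conv_lhs => rw [← funPart_add_ofDisc x, map_add, proj_ofDisc, funPart_add, funPart_ofDisc,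
    add_zero]
  exact funPart_of_discPart_eq_zero (by rw [discPart_proj, discPart_funPart])

lemma sub_proj_eq (J : Fin m → ℕ) (x : X d m l) :
    x - proj l J x = funPart x - proj l J (funPart x) := by
  conv_lhs => rw [← funPart_add_ofDisc x, map_add, proj_ofDisc, add_sub_add_right_eq_sub]

lemma proj_mem_ball {z : ℝ≥0∞} {γ : ℝ × ℝ} (J : Fin m → ℕ) {x : X d m l} (hx : x ∈ ball z γ) :
    proj l J x ∈ ball z γ := by
  refine ⟨?_, ?_⟩
  · rw [funPart_proj]
    exact (Submodule.norm_starProjection_apply_le _ _).trans hx.1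
  · rw [discPart_proj]
    exact hx.2

lemma proj_mem (J : Fin m → ℕ) (x : X d m l) : proj l J x ∈ polySpace d l J :=
  Submodule.starProjection_apply_mem _ _

/-- The effect of projecting the argument of a linear functional, on `B_γ`. -/
lemma abs_inner_sub_proj_le {z : ℝ≥0∞} {γ : ℝ × ℝ} (J : Fin m → ℕ) {x : X d m l}
    (hx : x ∈ ball z γ) (a : X d m l) :
    |inner ℝ a x - inner ℝ a (proj l J x)| ≤ γ.1 * ‖funPart a - proj l J (funPart a)‖ := by
  have h1 : inner ℝ a (proj l J x) = inner ℝ (proj l J a) x :=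
    (Submodule.inner_starProjection_left_eq_right (polySpace d l J) a x).symm
  have h2 : discPart (a - proj l J a) = 0 := by rw [discPart_sub, discPart_proj, sub_self]
  rw [h1, ← inner_sub_left, inner_eq_funPart_add_discPart, h2, funPart_of_discPart_eq_zero h2,
    sub_proj_eq]
  simp only [Pi.zero_apply, zero_mul, Finset.sum_const_zero, add_zero]
  rw [mul_comm]
  exact (abs_real_inner_le_norm _ _).trans (mul_le_mul_of_nonneg_left hx.1 (norm_nonneg _))

/-! ### Approximation by piecewise polynomials -/

lemma pairwise_disjoint_cube (hd : 0 < d) :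
    Pairwise (Function.onFun Disjoint fun i : Fin m => cube d (center i)) := by
  intro i j hij
  rw [Function.onFun, Set.disjoint_left]
  intro y hi hj
  have h1 := hi.1 ⟨0, hd⟩
  have h2 := hi.2 ⟨0, hd⟩
  have h3 := hj.1 ⟨0, hd⟩
  have h4 := hj.2 ⟨0, hd⟩
  simp only [center] at h1 h2 h3 h4
  have h5 : ((i : ℕ) : ℝ) < (j : ℕ) + 1 := by linarith
  have h6 : ((j : ℕ) : ℝ) < (i : ℕ) + 1 := by linarith
  norm_cast at h5 h6
  exact hij (Fin.ext (by omega))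

lemma measurableSet_cube (t : ℝ) : MeasurableSet (cube d t) := measurableSet_Icc

lemma restrict_cube_eq (t : ℝ) :
    (volume : Measure (Fin d → ℝ)).restrict (cube d t) = volume.restrict (openCube d t) :=
  Measure.restrict_congr_set Measure.univ_pi_Ioo_ae_eq_Icc.symm

/-- The piecewise polynomial function given by the polynomial `p i` on the `i`-th cube. -/
noncomputable def piecewisePoly (l : ℕ) (p : Fin m → MvPolynomial (Fin d) ℝ) :
    (Fin d → ℝ) ⊕ Fin l → ℝ :=
  Sum.elim (fun y => ∑ i, (cube d (center i)).indicator (fun y => eval y (p i)) y) fun _ => 0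

lemma piecewisePoly_of_mem (hd : 0 < d) (p : Fin m → MvPolynomial (Fin d) ℝ) {i : Fin m}
    {y : Fin d → ℝ} (hy : y ∈ cube d (center i)) :
    piecewisePoly l p (Sum.inl y) = eval y (p i) := by
  simp only [piecewisePoly, Sum.elim_inl]
  rw [Finset.sum_eq_single i, Set.indicator_of_mem hy]
  · intro j _ hj
    exact Set.indicator_of_notMem
      (fun h => Set.disjoint_left.1 (pairwise_disjoint_cube hd hj) h hy) _
  · simp

lemma memLp_piecewisePoly (p : Fin m → MvPolynomial (Fin d) ℝ) :
    MemLp (piecewisePoly l p) 2 (nu d m l) := by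
  have h (i : Fin m) := (isCompact_cube (d := d) (center i)).exists_bound_of_continuousOn
    (continuous_eval_poly (p i)).continuousOn
  choose M hM using h
  refine MemLp.of_bound (Measurable.sumElim (Finset.measurable_sum _ fun i _ =>
    (continuous_eval_poly (p i)).measurable.indicator (measurableSet_cube _))
    measurable_const).aestronglyMeasurable (∑ i, |M i|) (Eventually.of_forall fun s => ?_)
  rcases s with y | i
  · simp only [piecewisePoly, Sum.elim_inl]
    refine (norm_sum_le _ _).trans (Finset.sum_le_sum fun i _ => ?_)
    by_cases hy : y ∈ cube d (center i)
    · rw [Set.indicator_of_mem hy]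
      exact (hM i y hy).trans (le_abs_self _)
    · rw [Set.indicator_of_notMem hy, norm_zero]
      exact abs_nonneg _
  · simpa [piecewisePoly] using Finset.sum_nonneg fun i _ => abs_nonneg (M i)

/-- Approximations of `x` by polynomials on the single cubes add up. -/
lemma norm_funPart_sub_proj_le (hd : 0 < d) (J : Fin m → ℕ) (x : X d m l) {B : ℝ} (hB : 0 ≤ B)
    (h : ∀ i : Fin m, ∃ p : MvPolynomial (Fin d) ℝ, p.totalDegree ≤ J i ∧
      ∫ y in openCube d (center i), (x (Sum.inl y) - eval y p) ^ 2 ≤ B ^ 2) :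
    ‖funPart x - proj l J (funPart x)‖ ≤ m * B := by
  choose p hp hpx using h
  set w : X d m l := (memLp_piecewisePoly p).toLp with hw
  have hwc : w =ᵐ[nu d m l] piecewisePoly l p := MemLp.coeFn_toLp _
  have hwi (i : Fin m) : ∀ᵐ y ∂volume.restrict (cube d (center i)),
      w (Sum.inl y) = eval y (p i) := by
    filter_upwards [ae_cube_of_ae_nu hwc i, ae_restrict_mem (measurableSet_cube _)] with y h1 h2
    rw [h1, piecewisePoly_of_mem hd p h2]
  have hwP : w ∈ polySpace d l J := fun i => ⟨p i, hp i, hwi i⟩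
  refine (norm_sub_starProjection_le (polySpace d l J) (funPart x) hwP).trans ?_
  have hdisc : discPart (funPart x - w) = 0 := by
    rw [discPart_sub, discPart_funPart, zero_sub, neg_eq_zero]
    exact funext fun i => discPart_eq_of_ae hwc i
  have hint := integrable_mul_X (funPart x - w) (funPart x - w)
  have hint' : IntegrableOn (fun y => (funPart x - w : X d m l) (Sum.inl y) *
      (funPart x - w : X d m l) (Sum.inl y)) (cubes d m) := by
    have h1 := hint.mono_measure (map_inl_le_nu (d := d) (m := m) (l := l))
    exact (embedding_inl.integrable_map_iff).1 h1
  have hsq : ‖funPart x - w‖ ^ 2 ≤ m * B ^ 2 := by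
    rw [← real_inner_self_eq_norm_sq, inner_X, hdisc]
    simp only [Pi.zero_apply, mul_zero, Finset.sum_const_zero, add_zero]
    rw [cubes, integral_iUnion_fintype (fun i => measurableSet_cube _) (pairwise_disjoint_cube hd)
      fun i => hint'.mono_set
        (Set.subset_iUnion (fun i : Fin m => cube d (center i)) i)]
    calc _ ≤ ∑ _i : Fin m, B ^ 2 := Finset.sum_le_sum fun i _ => ?_
      _ = m * B ^ 2 := by simp
    refine le_of_eq_of_le ?_ (hpx i)
    rw [← restrict_cube_eq]
    refine integral_congr_ae ?_
    filter_upwards [hwi i, ae_cube_of_ae_nu (Lp.coeFn_sub (funPart x) w) i,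
      ae_cube_of_ae_nu (coeFn_funPart x) i] with y h1 h2 h3
    rw [h2, Pi.sub_apply, h1, h3, Set.indicator_of_mem (Set.mem_range_self y), sq]
  rcases Nat.eq_zero_or_pos m with rfl | hm
  · have : ‖funPart x - w‖ ^ 2 ≤ 0 := by simpa using hsq
    have : ‖funPart x - w‖ = 0 := by nlinarith [norm_nonneg (funPart x - w)]
    simp [this]
  · have hm' : (1 : ℝ) ≤ m := by exact_mod_cast hm
    refine (abs_le_of_sq_le_sq' (hsq.trans ?_) (by positivity)).2
    rw [mul_pow]
    exact mul_le_mul_of_nonneg_right (by nlinarith) (sq_nonneg B)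

lemma SmoothElt.norm_funPart_sub_proj_le {r k : ℕ} (hd : 0 < d) (hr : 1 ≤ r) (hk : r ≤ k)
    {J : Fin m → ℕ} (hJ : ∀ i, k ≤ J i) {C : ℝ} (hC : 0 ≤ C) {x : X d m l} (hx : SmoothElt r C x) :
    ‖funPart x - proj l J (funPart x)‖ ≤ m * (C * (d * (d * r / k : ℝ) ^ r)) := by
  refine GOT.norm_funPart_sub_proj_le hd J x (by positivity) fun i => ?_
  obtain ⟨p, hp, h⟩ := (hx i).1.exists_poly hr hd hk hC (hx i).2
  exact ⟨p, hp.trans (hJ i), h⟩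

variable {T : TopologicalSpace.Compacts (Fin d → ℝ)}

/-! ### The penalized program -/

/-- If `T` were empty, then `c = ∫ a dμ` would vanish, although `c` is `1` at `s*`. -/
lemma Regular.nonempty {θ : Param T m l} (h : Regular θ) : Nonempty T := by
  by_contra hT
  rw [not_nonempty_iff] at hT
  obtain ⟨⟨s, -, hc⟩, μ, -, hμ⟩ := h
  rw [Measure.eq_zero_of_isEmpty μ, integral_zero_measure] at hμ
  rw [hμ, discPart_zero] at hc
  exact zero_ne_one hc

lemma bddAbove_constraint (θ : Param T m l) (x : X d m l) :
    BddAbove (Set.range fun t : T => θ.b t - inner ℝ (θ.a t) x) := by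
  have hc : Continuous fun t : T => θ.b t - inner ℝ (θ.a t) x :=
    θ.b.continuous.sub (θ.a.continuous.inner continuous_const)
  exact (isCompact_range hc).bddAbove

lemma le_penalty_excess (θ : Param T m l) (x : X d m l) (t : T) :
    θ.b t - inner ℝ (θ.a t) x ≤ max (⨆ t : T, (θ.b t - inner ℝ (θ.a t) x)) 0 :=
  (le_ciSup (bddAbove_constraint θ x) t).trans (le_max_left _ _)

/-- Comparison of penalty functions at two parameters and two points. -/
lemma penalty_le_add {θ θ' : Param T m l} {x x' : X d m l} {ε₁ ε₂ : ℝ} (hε : 0 ≤ ε₂)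
    (hc : inner ℝ θ'.c x' ≤ inner ℝ θ.c x + ε₁)
    (ha : ∀ t : T, θ'.b t - inner ℝ (θ'.a t) x' ≤ θ.b t - inner ℝ (θ.a t) x + ε₂) :
    penalty θ' x' ≤ penalty θ x + ε₁ + ε₂ := by
  have h1 : max (⨆ t : T, (θ'.b t - inner ℝ (θ'.a t) x')) 0 ≤
      max (⨆ t : T, (θ.b t - inner ℝ (θ.a t) x)) 0 + ε₂ := by
    have h0 : 0 ≤ max (⨆ t : T, (θ.b t - inner ℝ (θ.a t) x)) 0 + ε₂ :=
      add_nonneg (le_max_right _ _) hε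
    refine max_le (Real.iSup_le (fun t => (ha t).trans ?_) h0) h0
    exact add_le_add_left (le_penalty_excess θ x t) ε₂
  rw [penalty, penalty]
  linarith

/-- Weak duality: a dual feasible measure bounds the primary program below. -/
lemma Regular.bddBelow {θ : Param T m l} (h : Regular θ) : BddBelow
    ((fun x : X d m l => inner ℝ θ.c x) '' {x | ∀ t : T, 0 ≤ inner ℝ (θ.a t) x - θ.b t}) := by
  obtain ⟨-, μ, hμ, hc⟩ := h
  refine ⟨∫ t, θ.b t ∂μ, ?_⟩
  rintro _ ⟨x, hx, rfl⟩
  have ha : Integrable (fun t => θ.a t) μ :=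
    θ.a.continuous.integrable_of_hasCompactSupport (HasCompactSupport.of_compactSpace _)
  have hb : Integrable (fun t => θ.b t) μ :=
    θ.b.continuous.integrable_of_hasCompactSupport (HasCompactSupport.of_compactSpace _)
  have h1 : inner ℝ θ.c x = ∫ t, inner ℝ (θ.a t) x ∂μ := by
    rw [hc, real_inner_comm, ← integral_inner ha]
    simp only [real_inner_comm]
  simp only [h1]
  exact integral_mono hb (ha.inner_const x) fun t => sub_nonneg.1 (hx t)

/-- The penalty is exact: raising the coordinate `s*` of `x` by the largest violation of a
constraint makes `x` feasible, at the price of that violation. -/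
lemma Regular.beta_le_penalty {θ : Param T m l} (h : Regular θ) (x : X d m l) :
    beta θ ≤ penalty θ x := by
  obtain ⟨⟨s, ha, hc⟩, -⟩ := id h
  refine csInf_le h.bddBelow ⟨x + ofDisc d m
    (Pi.single s (max (⨆ t : T, (θ.b t - inner ℝ (θ.a t) x)) 0)), fun t => ?_, ?_⟩
  · rw [inner_add_right, inner_ofDisc_single, ha t, one_mul]
    linarith [le_penalty_excess θ x t]
  · simp only [inner_add_right, inner_ofDisc_single, hc, one_mul, penalty]

lemma Regular.bddBelow_penalty {θ : Param T m l} (h : Regular θ) (s : Set (X d m l)) :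
    BddBelow (penalty θ '' s) :=
  ⟨beta θ, by rintro _ ⟨x, -, rfl⟩; exact h.beta_le_penalty x⟩

lemma zero_mem_ball {z : ℝ≥0∞} (hz : 1 ≤ z) {γ : ℝ × ℝ} (hγ : 0 < γ.1 ∧ 0 < γ.2) :
    (0 : X d m l) ∈ ball z γ := by
  have : Fact (1 ≤ z) := ⟨hz⟩
  refine ⟨by rw [funPart_zero, norm_zero]; exact hγ.1.le, ?_⟩
  rw [discPart_zero, lzNorm, WithLp.toLp_zero, norm_zero]
  exact hγ.2.le

/-! ### The error terms -/

lemma bddAbove_funPart_sub (a a' : C(T, X d m l)) :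
    BddAbove (Set.range fun t : T => ‖funPart (a t) - funPart (a' t)‖) := by
  obtain ⟨M, hM⟩ := (isCompact_range
    ((a.continuous.sub a'.continuous).norm)).bddAbove
  refine ⟨M, ?_⟩
  rintro _ ⟨t, rfl⟩
  simp only [← funPart_sub]
  exact (norm_funPart_le _).trans (hM ⟨t, rfl⟩)

lemma bddAbove_lzNorm_sub {zs : ℝ≥0∞} (hzs : 1 ≤ zs) (a a' : C(T, X d m l)) :
    BddAbove (Set.range fun t : T => lzNorm zs (discPart (a t) - discPart (a' t))) :=
  (isCompact_range ((continuous_lzNorm hzs).comp ((continuous_discPart.comp a.continuous).sub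
    (continuous_discPart.comp a'.continuous)))).bddAbove

lemma bddAbove_norm_sub_proj (J : Fin m → ℕ) (a : C(T, X d m l)) :
    BddAbove (Set.range fun t : T => ‖funPart (a t) - proj l J (funPart (a t))‖) := by
  simp only [← sub_proj_eq]
  exact (isCompact_range (a.continuous.sub
    ((proj l J).continuous.comp a.continuous)).norm).bddAbove

section Errors
variable {z zs : ℝ≥0∞} {γ : ℝ × ℝ}

lemma abs_inner_sub_le_deltaA (hz : z.HolderConjugate zs) (hγ : 0 < γ.1 ∧ 0 < γ.2)
    (θh θ : Param T m l) {x : X d m l} (hx : x ∈ ball z γ) (t : T) :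
    |inner ℝ (θh.a t) x - inner ℝ (θ.a t) x| ≤ deltaA zs γ θh θ := by
  have hzs : 1 ≤ zs := have := hz.symm; ENNReal.HolderConjugate.one_le zs z
  rw [← inner_sub_left]
  refine (abs_inner_le_of_mem_ball hz hx _).trans ?_
  rw [funPart_sub, discPart_sub]
  exact add_le_add
    (mul_le_mul_of_nonneg_left (le_ciSup (bddAbove_funPart_sub θh.a θ.a) t) hγ.1.le)
    (mul_le_mul_of_nonneg_left (le_ciSup (bddAbove_lzNorm_sub hzs θh.a θ.a) t) hγ.2.le)

lemma abs_inner_sub_le_deltaC (hz : z.HolderConjugate zs)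
    (θh θ : Param T m l) {x : X d m l} (hx : x ∈ ball z γ) :
    |inner ℝ θh.c x - inner ℝ θ.c x| ≤ deltaC zs γ θh θ := by
  rw [← inner_sub_left]
  refine (abs_inner_le_of_mem_ball hz hx _).trans ?_
  rw [funPart_sub, discPart_sub, deltaC]

lemma abs_sub_le_deltaB (θh θ : Param T m l) (t : T) : |θh.b t - θ.b t| ≤ deltaB θh θ :=
  le_ciSup (f := fun t : T => |θh.b t - θ.b t|)
    (isCompact_range (θh.b.continuous.sub θ.b.continuous).abs).bddAbove t

/-- On `B_γ`, the penalty functions of two parameters differ by at most `δ^a + δ^b + δ^c`. -/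
lemma abs_penalty_sub_le (hz : z.HolderConjugate zs) (hγ : 0 < γ.1 ∧ 0 < γ.2) [Nonempty T]
    (θh θ : Param T m l) {x : X d m l} (hx : x ∈ ball z γ) :
    |penalty θh x - penalty θ x| ≤ deltaA zs γ θh θ + deltaB θh θ + deltaC zs γ θh θ := by
  have hA := abs_inner_sub_le_deltaA hz hγ θh θ hx
  have hB := abs_sub_le_deltaB θh θ
  have hC := abs_le.1 (abs_inner_sub_le_deltaC hz θh θ hx)
  obtain ⟨t₀⟩ := ‹Nonempty T›
  have hA0 := (abs_nonneg _).trans (hA t₀)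
  have hB0 := (abs_nonneg _).trans (hB t₀)
  have h1 := penalty_le_add (θ := θ) (θ' := θh) (x := x) (x' := x) (ε₁ := deltaC zs γ θh θ)
    (add_nonneg hA0 hB0) (by linarith [hC.2]) fun t => by
      linarith [(abs_le.1 (hA t)).1, (abs_le.1 (hB t)).2]
  have h2 := penalty_le_add (θ := θh) (θ' := θ) (x := x) (x' := x) (ε₁ := deltaC zs γ θh θ)
    (add_nonneg hA0 hB0) (by linarith [hC.1]) fun t => by
      linarith [(abs_le.1 (hA t)).2, (abs_le.1 (hB t)).1]
  exact abs_le.2 ⟨by linarith, by linarith⟩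

/-- On `B_γ`, projecting onto the sieve space raises the penalty function by at most `δ^p`. -/
lemma penalty_proj_le (hγ : 0 < γ.1) (J : Fin m → ℕ) (θ : Param T m l) {x : X d m l}
    (hx : x ∈ ball z γ) : penalty θ (proj l J x) ≤ penalty θ x + deltaP J γ θ := by
  have hs := bddAbove_norm_sub_proj J θ.a
  have h := penalty_le_add (θ := θ) (θ' := θ) (x := x) (x' := proj l J x)
    (ε₁ := γ.1 * ‖funPart θ.c - proj l J (funPart θ.c)‖)
    (ε₂ := γ.1 * ⨆ t : T, ‖funPart (θ.a t) - proj l J (funPart (θ.a t))‖)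
    (mul_nonneg hγ.le (Real.iSup_nonneg fun t => norm_nonneg _))
    (by linarith [(abs_le.1 (abs_inner_sub_proj_le J hx θ.c)).1]) fun t => by
      have h1 := (abs_le.1 (abs_inner_sub_proj_le J hx (θ.a t))).2
      have h2 := mul_le_mul_of_nonneg_left (le_ciSup hs t) hγ.le
      linarith
  rw [deltaP, mul_add]
  linarith

variable {θ θh : Param T m l}

/-- The lower bound: `β` is a lower bound of the exact penalty function, and `B_γ ∩ 𝐏_J` is a
part of `B_γ`, on which the parameter `θh` may be replaced by `θ`. -/
lemma Regular.neg_le_betaJ_sub (h : Regular θ) (hz : z.HolderConjugate zs)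
    (hγ : 0 < γ.1 ∧ 0 < γ.2) (J : Fin m → ℕ) :
    -(deltaA zs γ θh θ + deltaB θh θ + deltaC zs γ θh θ) ≤ betaJ z J θh γ - beta θ := by
  have := h.nonempty
  have h1 : beta θ - (deltaA zs γ θh θ + deltaB θh θ + deltaC zs γ θh θ) ≤ betaJ z J θh γ := by
    refine le_csInf ⟨_, 0, ⟨zero_mem_ball (ENNReal.HolderConjugate.one_le z zs) hγ,
      zero_mem _⟩, rfl⟩ ?_
    rintro _ ⟨x, hx, rfl⟩
    linarith [(abs_le.1 (abs_penalty_sub_le hz hγ θh θ hx.1)).1, h.beta_le_penalty x]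
  linarith

/-- The upper bound: the projection of a point of `B_γ` is a candidate for the infimum over
`B_γ ∩ 𝐏_J`. -/
lemma Regular.betaJ_le (h : Regular θ) (hz : z.HolderConjugate zs)
    (hγ : 0 < γ.1 ∧ 0 < γ.2) (J : Fin m → ℕ) :
    betaJ z J θh γ ≤ betaInf z θ γ +
      (deltaA zs γ θh θ + deltaB θh θ + deltaC zs γ θh θ + deltaP J γ θ) := by
  have := h.nonempty
  rw [← sub_le_iff_le_add]
  refine le_csInf ⟨_, 0, zero_mem_ball (ENNReal.HolderConjugate.one_le z zs) hγ, rfl⟩ ?_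
  rintro _ ⟨x, hx, rfl⟩
  have hbdd : BddBelow (penalty θh '' (ball z γ ∩ (polySpace d l J : Set (X d m l)))) := by
    refine ⟨beta θ - (deltaA zs γ θh θ + deltaB θh θ + deltaC zs γ θh θ), ?_⟩
    rintro _ ⟨y, hy, rfl⟩
    linarith [(abs_le.1 (abs_penalty_sub_le hz hγ θh θ hy.1)).1, h.beta_le_penalty y]
  have h1 : betaJ z J θh γ ≤ penalty θh (proj l J x) :=
    csInf_le hbdd ⟨_, ⟨proj_mem_ball J hx, proj_mem J x⟩, rfl⟩
  linarith [(abs_le.1 (abs_penalty_sub_le hz hγ θh θ (proj_mem_ball J hx))).2,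
    penalty_proj_le hγ.1 J θ hx]

end Errors

/-- By the monotonicity assumption the penalized values over a fixed `B_γ` decrease with `n`. -/
lemma Changing.betaInf_le {z : ℝ≥0∞} (hz : 1 ≤ z) {m l : ℕ → ℕ} {θ : ∀ n, Param T (m n) (l n)}
    (h : Changing z θ) {γ : ℝ × ℝ} (hγ : 0 < γ.1 ∧ 0 < γ.2) (n : ℕ) :
    betaInf z (θ n) γ ≤ betaInf z (θ 0) γ := by
  refine antitone_nat_of_succ_le (f := fun n => betaInf z (θ n) γ) (fun n => ?_) (Nat.zero_le n)
  refine le_csInf ⟨_, 0, zero_mem_ball hz hγ, rfl⟩ ?_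
  rintro _ ⟨x₀, hx, rfl⟩
  obtain ⟨x₁, h1, h2, h3⟩ := h.monotone n x₀
  exact csInf_le ((h.regular (n + 1)).bddBelow_penalty _)
    ⟨x₁, ⟨h1.trans hx.1, h2.trans hx.2⟩, h3⟩

/-- The rate of the error of polynomial approximation under Sobolev smoothness. -/
lemma Smooth.deltaP_le {r k : ℕ} (hd : 0 < d) (hr : 1 ≤ r) (hk : r ≤ k) {J : Fin m → ℕ}
    (hJ : ∀ i, k ≤ J i) {C : ℝ} (hC : 0 ≤ C) {θ : Param T m l} (hθ : Smooth r C θ) {γ : ℝ × ℝ}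
    (hγ : 0 ≤ γ.1) :
    deltaP J γ θ ≤ γ.1 * (m * C * (2 * d * (d * r : ℝ) ^ r) * ((k : ℝ) ^ r)⁻¹) := by
  have h1 := hθ.1.norm_funPart_sub_proj_le hd hr hk hJ hC
  have h2 : ⨆ t : T, ‖funPart (θ.a t) - proj l J (funPart (θ.a t))‖ ≤
      m * (C * (d * (d * r / k : ℝ) ^ r)) :=
    Real.iSup_le (fun t => (hθ.2 t).norm_funPart_sub_proj_le hd hr hk hJ hC) (by positivity)
  refine mul_le_mul_of_nonneg_left ((add_le_add h1 h2).trans_eq ?_) hγ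
  rw [div_pow]
  ring

end GOT

theorem theorem4 (d r : ℕ) (hd : 0 < d) (hr : 0 < r) :
    ∃ Ct : ℝ, 0 < Ct ∧
      ∀ (T : TopologicalSpace.Compacts (Fin d → ℝ)) (z zs : ℝ≥0∞) (_ : z.HolderConjugate zs)
        (m l : ℕ → ℕ) (θ θh : ∀ n, GOT.Param T (m n) (l n))
        (J : ∀ n, Fin (m n) → ℕ) (γ : ℕ → ℝ × ℝ) (_ : ∀ n, 0 < (γ n).1 ∧ 0 < (γ n).2),
        GOT.Changing z θ →
        (∀ n,
          -(GOT.deltaA zs (γ n) (θh n) (θ n) + GOT.deltaB (θh n) (θ n) +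
              GOT.deltaC zs (γ n) (θh n) (θ n)) ≤
            GOT.betaJ z (J n) (θh n) (γ n) - GOT.beta (θ 0) ∧
          GOT.betaJ z (J n) (θh n) (γ n) - GOT.beta (θ 0) ≤
            GOT.deltaA zs (γ n) (θh n) (θ n) + GOT.deltaB (θh n) (θ n) +
              GOT.deltaC zs (γ n) (θh n) (θ n) + GOT.deltaP (J n) (γ n) (θ n) +
              GOT.Delta z (θ n) (γ n) ∧
          GOT.Delta z (θ n) (γ n) ≤ GOT.Delta z (θ 0) (γ n)) ∧
        (∀ C : ℝ, 0 < C → (∀ n, GOT.Smooth r C (θ n)) →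
          ∀ n, r ≤ (⨅ i, J n i) → GOT.deltaP (J n) (γ n) (θ n) ≤
            (γ n).1 * ((m n : ℝ) * C * Ct * (((⨅ i, J n i : ℕ) : ℝ) ^ r)⁻¹)) := by
  have hd' : (0 : ℝ) < d := by exact_mod_cast hd
  have hr' : (0 : ℝ) < r := by exact_mod_cast hr
  -- the factor `2` accounts for the two terms of `δ^p`, one from `c` and one from `a`
  refine ⟨2 * d * (d * r : ℝ) ^ r, by positivity, ?_⟩
  intro T z zs hz m l θ θh J γ hγ hθ
  refine ⟨fun n => ?_, fun C hC hs n hk => ?_⟩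
  · have h1 := (hθ.regular n).neg_le_betaJ_sub (θh := θh n) hz (hγ n) (J n)
    have h2 := (hθ.regular n).betaJ_le (θh := θh n) hz (hγ n) (J n)
    have h3 := hθ.betaInf_le (ENNReal.HolderConjugate.one_le z zs) (hγ n) n
    simp only [GOT.Delta]
    rw [hθ.const n] at h1 ⊢
    exact ⟨h1, by linarith, by linarith⟩
  · exact (hs n).deltaP_le hd hr hk (fun i => ciInf_le (OrderBot.bddBelow _) i) hC.le (hγ n).1.le
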